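/- Let $G=(V,E)$ be a finite simple connected unweighted graph with $|V|=k\ge 1$, vertices $v_1,\dots,v_k$, and let $d$ be its shortest-path (edge-count) metric. Let $D_G=(d(v,w))_{v,w\in V}$ be its distance matrix, $\mathcal D_G:=D_G+2\,\mathrm{Id}_V$ its modified distance matrix, and $$p_G(n_1,\dots,n_k):=\det(-2\,\mathrm{Id}_V+\Delta_{\mathbf n}\mathcal D_G),\qquad \Delta_{\mathbf n}:=\mathrm{diag}(n_1,\dots,n_k),$$ its blowup-polynomial. Define the homogenized blowup-polynomial $$\widetilde p_G(z_0,z_1,\dots,z_k):=(-z_0)^k\,p_G\!\left(\tfrac{z_1}{-z_0},\dots,\tfrac{z_k}{-z_0}\right)\in\mathbb R[z_0,\dots,z_k].$$ Then the following are equivalent: 1. $\widetilde p_G$ is real-stable. 2. All coefficients of $\widetilde p_G$ are non-negative. 3. $(-1)^k p_G(-1,\dots,-1)>0$, and the polynomial $(z_1,\dots,z_k)\mapsto p_G(-z_1,\dots,-z_k)/p_G(-1,\dots,-1)$ is strongly Rayleigh, i.e. it is multi-affine and real-stable, with non-negative coefficients that sum to $1$. 4. $\mathcal D_G$ is positive semidefinite.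 5. $G$ is a complete multipartite graph. 6. $\widetilde p_G$ is Lorentzian. 7. $\widetilde p_G$ is strongly log-concave. 8. $\widetilde p_G$ is completely log-concave. Here a real polynomial is *real-stable* if it does not vanish when all its arguments have positive imaginary part. A homogeneous real polynomial of degree $d$ in finitely many variables is *strictly Lorentzian* if the coefficients of all monomials of degree $d$ are positive and, for every partial derivative $g$ of it of order $d-2$ (if $d\ge 2$), the Hessian matrix of $g$ is nonsingular with exactly one positive eigenvalue; a homogeneous polynomial of degree $d$ is *Lorentzian* if it is a coefficientwise limit of strictly Lorentzian polynomials of degree $d$. A polynomial $p$ with non-negative coefficients is *strongly log-concave* if, for every multi-index $\alpha$, either $\partial^\alpha p\equiv 0$, or $\partial^\alpha p$ is positive and $\log(\partial^\alpha p)$ is concave on the open positive orthant; it is *completely log-concave* if, for all $m\ge 0$ and all $m$-row matrices $A=(a_{ij})$ with non-negative entries, either $\partial_A p:=\prod_{i=1}^m\big(\sum_j a_{ij}\partial_j\big)p\equiv 0$, or $\partial_A p$ is positive and $\log(\partial_A p)$ is concave on the open positive orthant. -/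

import Mathlib

open MvPolynomial Matrix Filter Topology

namespace Blowup

section Graphs

/-- The distance matrix `D_G` of a graph: the `(v, w)` entry is the number of edges of a shortest
path from `v` to `w`. -/
noncomputable def distMatrix {V : Type*} (G : SimpleGraph V) : Matrix V V ℝ :=
  Matrix.of fun v w => (G.dist v w : ℝ)

/-- The modified distance matrix `D_G + 2 Id`. (In a connected graph with at least two vertices
every vertex is at distance `1` from the others, so that `2 Id` is the diagonal matrix with
entries `2 d(v, V \ {v})`.) -/
noncomputable def modDistMatrix {V : Type*} [DecidableEq V] (G : SimpleGraph V) : Matrix V V ℝ :=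
  distMatrix G + Matrix.diagonal fun _ => 2

/-- The blowup-polynomial `p_G(n) = det (-2 Id + Δ_n 𝒟_G)`, where `Δ_n` is the diagonal matrix of
the indeterminates `n_v` and `𝒟_G` is the modified distance matrix. -/
noncomputable def blowupPoly {V : Type*} [Fintype V] [DecidableEq V] (G : SimpleGraph V) :
    MvPolynomial V ℝ :=
  (Matrix.diagonal (fun _ => (C (-2) : MvPolynomial V ℝ)) +
    Matrix.diagonal (fun v => (X v : MvPolynomial V ℝ)) *
      (modDistMatrix G).map (fun a => (C a : MvPolynomial V ℝ))).det

/-- The homogenized blowup-polynomial `(-z₀)^k p_G(z₁ / (-z₀), …, z_k / (-z₀))`, `k = |V|`, in the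
variables `z₀ = X none` and `z_v = X (some v)`: a monomial `a ∏ n_v ^ (m v)` of `p_G` becomes
`a (-z₀) ^ (k - ∑ m v) ∏ z_v ^ (m v)`. -/
noncomputable def homBlowupPoly {V : Type*} [Fintype V] [DecidableEq V] (G : SimpleGraph V) :
    MvPolynomial (Option V) ℝ :=
  ∑ m ∈ (blowupPoly G).support, C ((blowupPoly G).coeff m) *
    (-X none) ^ (Fintype.card V - ∑ v, m v) * ∏ v, X (some v) ^ m v

/-- The normalized reflected polynomial `p_G(-z) / p_G(-1, …, -1)`. -/
noncomputable def reflectedBlowupPoly {V : Type*} [Fintype V] [DecidableEq V]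
    (G : SimpleGraph V) : MvPolynomial V ℝ :=
  C (eval (fun _ => (-1 : ℝ)) (blowupPoly G))⁻¹ * bind₁ (fun v => -X v) (blowupPoly G)

/-- The distance matrix of the blowup `G[n]`, with `n v` copies of each vertex `v`: copies of
distinct vertices are as far apart as these vertices, and distinct copies of the same vertex are at
distance `2`. -/
noncomputable def blowupDistMatrix {V : Type*} [DecidableEq V] (G : SimpleGraph V) (n : V → ℕ) :
    Matrix (Σ v, Fin (n v)) (Σ v, Fin (n v)) ℝ :=
  Matrix.of fun x y => if x = y then 0 else if x.1 = y.1 then 2 else (G.dist x.1 y.1 : ℝ)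

theorem eval_blowupPoly {V : Type*} [Fintype V] [DecidableEq V] (G : SimpleGraph V) (z : V → ℝ) :
    eval z (blowupPoly G) =
      (Matrix.diagonal (fun _ => (-2 : ℝ)) + Matrix.diagonal z * modDistMatrix G).det := by
  unfold blowupPoly
  rw [RingHom.map_det]
  congr 1
  ext i j
  simp [Matrix.diagonal_mul, Matrix.diagonal_apply, apply_ite (eval z)]

/-- The blowup-polynomial encodes the determinants of the distance matrices of all blowups. -/
theorem det_blowupDistMatrix {V : Type*} [Fintype V] [DecidableEq V] (G : SimpleGraph V)
    (n : V → ℕ) (hn : ∀ v, 0 < n v) :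
    (blowupDistMatrix G n).det =
      eval (fun v => (n v : ℝ)) (blowupPoly G) * ∏ v, (-2 : ℝ) ^ (n v - 1) := by
  let W : Matrix (Σ v, Fin (n v)) V ℝ := Matrix.of fun x v => if x.1 = v then 1 else 0
  have key : ∀ {ι : Type _} [Fintype ι] [DecidableEq ι] (M : Matrix ι ι ℝ),
      (Matrix.diagonal (fun _ => (-2 : ℝ)) + M).det =
        (-2) ^ Fintype.card ι * (1 + (-(1 / 2 : ℝ)) • M).det := by
    intro ι _ _ M
    rw [← Matrix.det_smul]
    congr 1
    ext i j
    simp [Matrix.one_apply, Matrix.diagonal_apply]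
    split_ifs <;> ring
  have h1 : blowupDistMatrix G n =
      Matrix.diagonal (fun _ => (-2 : ℝ)) + (W * modDistMatrix G) * Wᵀ := by
    ext x y
    by_cases hxy : x = y
    · subst hxy
      simp [blowupDistMatrix, W, Matrix.mul_apply, modDistMatrix, distMatrix]
    · by_cases h : x.1 = y.1
      · simp [blowupDistMatrix, W, Matrix.mul_apply, modDistMatrix, distMatrix, hxy, h]
      · simp [blowupDistMatrix, W, Matrix.mul_apply, modDistMatrix, distMatrix, hxy, h]
  have h2 : Wᵀ * W = Matrix.diagonal (fun v => (n v : ℝ)) := by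
    ext v w
    rw [Matrix.mul_apply, Fintype.sum_sigma]
    by_cases h : v = w
    · subst h
      simp [W]
    · simp [W, h, Ne.symm h]
  have h3 : ∏ v, (-2 : ℝ) ^ (n v) = (-2) ^ Fintype.card V * ∏ v, (-2 : ℝ) ^ (n v - 1) := by
    rw [← Finset.card_univ, ← Finset.prod_const, ← Finset.prod_mul_distrib]
    refine Finset.prod_congr rfl fun v _ => ?_
    rw [← pow_succ', Nat.sub_add_cancel (hn v)]
  have h4 : (1 + (-(1 / 2 : ℝ)) • (W * modDistMatrix G * Wᵀ)).det =
      (1 + (-(1 / 2 : ℝ)) • (Matrix.diagonal (fun v => (n v : ℝ)) * modDistMatrix G)).det := by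
    rw [← Matrix.mul_smul, Matrix.det_one_add_mul_comm, Matrix.smul_mul, ← Matrix.mul_assoc, h2]
  rw [eval_blowupPoly, h1, key, key, h4, Fintype.card_sigma, ← Finset.prod_pow_eq_pow_sum]
  simp only [Fintype.card_fin]
  rw [h3]
  ring

theorem sum_le_of_mem_support_blowupPoly {V : Type*} [Fintype V] [DecidableEq V]
    (G : SimpleGraph V) {m : V →₀ ℕ} (hm : m ∈ (blowupPoly G).support) :
    ∑ v, m v ≤ Fintype.card V := by
  have h0 : (blowupPoly G).totalDegree ≤ Fintype.card V := by
    unfold blowupPoly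
    rw [Matrix.det_apply]
    refine totalDegree_finsetSum_le fun τ _ => ?_
    refine (totalDegree_smul_le _ _).trans ?_
    refine (totalDegree_finsetProd _ _).trans ?_
    rw [← Finset.card_univ, Finset.card_eq_sum_ones]
    refine Finset.sum_le_sum fun v _ => ?_
    rw [Matrix.add_apply, Matrix.diagonal_mul, Matrix.map_apply]
    refine (totalDegree_add _ _).trans (max_le ?_ ?_)
    · rw [Matrix.diagonal_apply]
      split_ifs <;> simp
    · refine (totalDegree_mul _ _).trans ?_
      simp
  have h1 := (le_totalDegree hm).trans h0
  rwa [Finsupp.sum_fintype _ _ (fun _ => rfl)] at h1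

/-- The homogenization is the polynomial given by the defining formula. -/
theorem eval_homBlowupPoly {V : Type*} [Fintype V] [DecidableEq V] (G : SimpleGraph V)
    (z : Option V → ℝ) (h : z none ≠ 0) :
    eval z (homBlowupPoly G) = (-z none) ^ Fintype.card V *
      eval (fun v => z (some v) / (-z none)) (blowupPoly G) := by
  have h' : -z none ≠ 0 := neg_ne_zero.mpr h
  rw [eval_eq' _ (blowupPoly G), homBlowupPoly, map_sum, Finset.mul_sum]
  refine Finset.sum_congr rfl fun m hm => ?_
  have hle := sum_le_of_mem_support_blowupPoly G hm
  simp only [map_mul, map_pow, map_neg, eval_C, eval_X, map_prod, div_pow,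
    Finset.prod_div_distrib, Finset.prod_pow_eq_pow_sum]
  rw [pow_sub₀ _ h' hle]
  field_simp

end Graphs

section Polynomials

/-- Real-stable: the polynomial (with real coefficients) does not vanish when all its arguments lie
in the open upper half-plane. -/
def IsRealStable {σ : Type*} (p : MvPolynomial σ ℝ) : Prop :=
  ∀ z : σ → ℂ, (∀ i, 0 < (z i).im) → aeval z p ≠ 0

def HasNonnegCoeffs {σ : Type*} (p : MvPolynomial σ ℝ) : Prop :=
  ∀ m, 0 ≤ p.coeff m

def IsMultiAffine {σ : Type*} (p : MvPolynomial σ ℝ) : Prop :=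
  ∀ m ∈ p.support, ∀ i, m i ≤ 1

/-- Strongly Rayleigh: multi-affine, real-stable, with non-negative coefficients that sum
to `1`. -/
def IsStronglyRayleigh {σ : Type*} (p : MvPolynomial σ ℝ) : Prop :=
  IsMultiAffine p ∧ IsRealStable p ∧ HasNonnegCoeffs p ∧ ∑ m ∈ p.support, p.coeff m = 1

/-- The iterated partial derivative along a list of variables. As partial derivatives commute, the
operators `∂^α` with `α` a multi-index are exactly those given by lists, and lists of length `m`
give those of order `|α| = m`. -/
noncomputable def iterPDeriv {σ : Type*} (l : List σ) (p : MvPolynomial σ ℝ) : MvPolynomial σ ℝ :=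
  l.foldr (fun i q => pderiv i q) p

/-- The directional derivative `∑ j, a j ∂_j`. -/
noncomputable def dirDeriv {σ : Type*} [Fintype σ] (a : σ → ℝ) (p : MvPolynomial σ ℝ) :
    MvPolynomial σ ℝ :=
  ∑ j, a j • pderiv j p

/-- The derivative `∏ i, (∑ j, A i j ∂_j)` given by the rows of a matrix `A`. -/
noncomputable def matrixDeriv {σ : Type*} [Fintype σ] {m : ℕ} (A : Matrix (Fin m) σ ℝ)
    (p : MvPolynomial σ ℝ) : MvPolynomial σ ℝ :=
  (List.ofFn A).foldr dirDeriv p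

/-- The Hessian matrix of `p` at the origin; for a quadratic form the Hessian is constant. -/
noncomputable def hessian {σ : Type*} (p : MvPolynomial σ ℝ) : Matrix σ σ ℝ :=
  Matrix.of fun i j => eval 0 (pderiv i (pderiv j p))

/-- A real symmetric matrix is Lorentzian if it is nonsingular and has exactly one positive
eigenvalue (counted with multiplicity). -/
def IsLorentzianMatrix {σ : Type*} [Fintype σ] [DecidableEq σ] (A : Matrix σ σ ℝ) : Prop :=
  ∃ hA : A.IsHermitian, A.det ≠ 0 ∧ ∃! i, 0 < hA.eigenvalues i

/-- Strictly Lorentzian polynomials of degree `d`: homogeneous polynomials, all of whose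
coefficients (of all monomials of degree `d`) are positive, such that each partial derivative of
order `d - 2` has a Lorentzian Hessian matrix. -/
def IsStrictlyLorentzian {σ : Type*} [Fintype σ] [DecidableEq σ] (d : ℕ)
    (p : MvPolynomial σ ℝ) : Prop :=
  p.IsHomogeneous d ∧ (∀ m : σ →₀ ℕ, ∑ i, m i = d → 0 < p.coeff m) ∧
    ∀ l : List σ, l.length + 2 = d → IsLorentzianMatrix (hessian (iterPDeriv l p))

/-- Lorentzian polynomials (Brändén-Huh): the limits of strictly Lorentzian polynomials in the
(finite-dimensional) space of homogeneous polynomials of some degree `d`. -/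
def IsLorentzian {σ : Type*} [Fintype σ] [DecidableEq σ] (p : MvPolynomial σ ℝ) : Prop :=
  ∃ d : ℕ, p.IsHomogeneous d ∧ ∃ q : ℕ → MvPolynomial σ ℝ,
    (∀ N, IsStrictlyLorentzian d (q N)) ∧
      ∀ m : σ →₀ ℕ, Tendsto (fun N => (q N).coeff m) atTop (𝓝 (p.coeff m))

/-- `log p` is defined and concave on the open positive orthant. -/
def IsLogConcave {σ : Type*} (p : MvPolynomial σ ℝ) : Prop :=
  (∀ x : σ → ℝ, (∀ i, 0 < x i) → 0 < eval x p) ∧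
    ConcaveOn ℝ {x : σ → ℝ | ∀ i, 0 < x i} (fun x => Real.log (eval x p))

/-- Strongly log-concave (Gurvits). -/
def IsStronglyLogConcave {σ : Type*} (p : MvPolynomial σ ℝ) : Prop :=
  HasNonnegCoeffs p ∧ ∀ l : List σ, iterPDeriv l p = 0 ∨ IsLogConcave (iterPDeriv l p)

/-- Completely log-concave (Anari-Oveis Gharan-Vinzant). The matrix with `m = 0` rows, that is the
polynomial itself, is included. -/
def IsCompletelyLogConcave {σ : Type*} [Fintype σ] (p : MvPolynomial σ ℝ) : Prop :=
  HasNonnegCoeffs p ∧ ∀ (m : ℕ) (A : Matrix (Fin m) σ ℝ), (∀ i j, 0 ≤ A i j) →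
    matrixDeriv A p = 0 ∨ IsLogConcave (matrixDeriv A p)

end Polynomials

end Blowup

/-! After homogenization the blowup-polynomial is P = det(2 z₀ + Δ_z D), with D the modified
distance matrix. Everything is linked to positive semidefiniteness of D.

Necessity: each of the other analytic conditions keeps P from vanishing on the open positive
orthant. At z₀ = s/2 and z_v = 1 this says det(s + D) ≠ 0 for all s > 0, so D has no negative
eigenvalue. On the graph side, D = J + WᵀW for a complete multipartite graph, J being the all-ones
matrix and W the incidence matrix of the parts; otherwise an edge and a vertex adjacent to neither
of its ends give a vector on which the form of D is negative.

Sufficiency: if D is positive semidefinite, P is stable (`det_pencil_ne_zero`). To reach the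
Lorentzian and log-concave conditions, D is replaced by D + ε and each z_i by z_i + ε ∑ z_j. The
resulting polynomial is stable with respect to an open cone that contains every nonzero non-negative
vector. Derivatives along the cone stay stable, by Gauss–Lucas (`IsConeStable.dirDeriv`). Down to
degree 0 this makes all coefficients positive. In degree 2 stability is a reversed Cauchy–Schwarz
inequality, so the Hessian has one positive eigenvalue; its kernel consists of the directions in
which the whole polynomial is constant (`IsConeStable.dirDeriv_eq_zero_of_foldr`), and for ε > 0
there are none but 0. Along lines a stable polynomial is real-rooted, hence log-concave on the cone
(`IsConeStable.concaveOn_log`). Letting ε → 0 gives the Lorentzian property, hence non-negative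
coefficients, and complete log-concavity. -/

namespace Blowup

/-! ### Directional derivatives of polynomials -/

section Derivatives

variable {σ : Type*}

theorem pderiv_comm (i j : σ) (p : MvPolynomial σ ℝ) :
    pderiv i (pderiv j p) = pderiv j (pderiv i p) := by
  ext m
  simp only [coeff_pderiv, Finsupp.add_apply]
  rw [add_right_comm m]
  by_cases h : i = j
  · subst h; ring
  · simp [h, Ne.symm h]; ring

theorem aeval_mul_of_isHomogeneous {A : Type*} [CommRing A] [Algebra ℝ A] {d : ℕ}
    {f : MvPolynomial σ ℝ} (hf : f.IsHomogeneous d) (c : A) (z : σ → A) :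
    aeval (fun i => c * z i) f = c ^ d * aeval z f := by
  rw [aeval_def, aeval_def, eval₂_eq, eval₂_eq, Finset.mul_sum]
  refine Finset.sum_congr rfl fun m hm => ?_
  have h : m.degree = d := by
    by_contra h
    exact (mem_support_iff.1 hm) (hf.coeff_eq_zero h)
  rw [← h, Finsupp.degree_apply, ← Finset.prod_pow_eq_pow_sum]
  simp only [mul_pow, Finset.prod_mul_distrib]
  ring

variable [Fintype σ]

theorem dirDeriv_add (a : σ → ℝ) (p q : MvPolynomial σ ℝ) :
    dirDeriv a (p + q) = dirDeriv a p + dirDeriv a q := by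
  simp [dirDeriv, Finset.sum_add_distrib]

theorem dirDeriv_smul (a : σ → ℝ) (c : ℝ) (p : MvPolynomial σ ℝ) :
    dirDeriv a (c • p) = c • dirDeriv a p := by
  simp [dirDeriv, Finset.smul_sum, smul_comm c]

theorem dirDeriv_zero (a : σ → ℝ) : dirDeriv a (0 : MvPolynomial σ ℝ) = 0 := by
  simp [dirDeriv]

theorem dirDeriv_sum {ι : Type*} (s : Finset ι) (a : σ → ℝ) (p : ι → MvPolynomial σ ℝ) :
    dirDeriv a (∑ i ∈ s, p i) = ∑ i ∈ s, dirDeriv a (p i) := by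
  classical
  induction s using Finset.induction_on with
  | empty => simp [dirDeriv_zero]
  | insert i s hi ih => rw [Finset.sum_insert hi, Finset.sum_insert hi, dirDeriv_add, ih]

theorem add_dirDeriv (a b : σ → ℝ) (p : MvPolynomial σ ℝ) :
    dirDeriv (a + b) p = dirDeriv a p + dirDeriv b p := by
  simp [dirDeriv, add_smul, Finset.sum_add_distrib]

theorem smul_dirDeriv (c : ℝ) (a : σ → ℝ) (p : MvPolynomial σ ℝ) :
    dirDeriv (c • a) p = c • dirDeriv a p := by
  simp [dirDeriv, Finset.smul_sum, smul_smul]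

theorem zero_dirDeriv (p : MvPolynomial σ ℝ) : dirDeriv (0 : σ → ℝ) p = 0 := by
  simp [dirDeriv]

theorem single_dirDeriv [DecidableEq σ] (i : σ) (p : MvPolynomial σ ℝ) :
    dirDeriv (Pi.single i 1) p = pderiv i p := by
  simp [dirDeriv, Pi.single_apply]

theorem dirDeriv_comm (a b : σ → ℝ) (p : MvPolynomial σ ℝ) :
    dirDeriv a (dirDeriv b p) = dirDeriv b (dirDeriv a p) := by
  rw [dirDeriv.eq_def b p, dirDeriv_sum, dirDeriv.eq_def b (dirDeriv a p)]
  refine Finset.sum_congr rfl fun i _ => ?_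
  rw [dirDeriv_smul]
  congr 1
  simp [dirDeriv, pderiv_comm i]

theorem dirDeriv_foldr_comm (a : σ → ℝ) (l : List (σ → ℝ)) (p : MvPolynomial σ ℝ) :
    dirDeriv a (l.foldr dirDeriv p) = l.foldr dirDeriv (dirDeriv a p) := by
  induction l with
  | nil => rfl
  | cons b l ih => rw [List.foldr_cons, dirDeriv_comm, ih, List.foldr_cons]

theorem foldr_dirDeriv_zero (l : List (σ → ℝ)) :
    l.foldr dirDeriv (0 : MvPolynomial σ ℝ) = 0 := by
  induction l with
  | nil => rfl
  | cons a l ih => rw [List.foldr_cons, ih, dirDeriv_zero]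

theorem iterPDeriv_eq_foldr_dirDeriv [DecidableEq σ] (l : List σ) (p : MvPolynomial σ ℝ) :
    iterPDeriv l p = (l.map fun i => Pi.single i (1 : ℝ)).foldr dirDeriv p := by
  induction l with
  | nil => rfl
  | cons i l ih =>
    rw [List.map_cons, List.foldr_cons, ← ih, single_dirDeriv]
    rfl

theorem isHomogeneous_dirDeriv {d : ℕ} {p : MvPolynomial σ ℝ} (hp : p.IsHomogeneous (d + 1))
    (a : σ → ℝ) : (dirDeriv a p).IsHomogeneous d := by
  refine IsHomogeneous.sum _ _ _ fun i _ => ?_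
  rw [smul_eq_C_mul]
  exact (hp.pderiv (i := i)).C_mul _

theorem dirDeriv_eq_zero_of_isHomogeneous_zero {p : MvPolynomial σ ℝ} (hp : p.IsHomogeneous 0)
    (a : σ → ℝ) : dirDeriv a p = 0 := by
  rw [← totalDegree_zero_iff_isHomogeneous, totalDegree_eq_zero_iff_eq_C] at hp
  rw [hp]
  simp [dirDeriv]

theorem eval_dirDeriv_self {d : ℕ} {p : MvPolynomial σ ℝ} (hp : p.IsHomogeneous d)
    (a : σ → ℝ) : eval a (dirDeriv a p) = d * eval a p := by
  have h := congrArg (eval a) hp.sum_X_mul_pderiv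
  simpa [dirDeriv, smul_eval] using h

theorem eq_zero_of_forall_dirDeriv_eq_zero {d : ℕ} {p : MvPolynomial σ ℝ}
    (hp : p.IsHomogeneous (d + 1)) (h : ∀ a, dirDeriv a p = 0) : p = 0 := by
  classical
  have h1 := hp.sum_X_mul_pderiv
  simp only [← single_dirDeriv, h, mul_zero, Finset.sum_const_zero] at h1
  have : ((d + 1 : ℕ) : ℝ) • p = 0 := by rw [Nat.cast_smul_eq_nsmul]; exact h1.symm
  exact (smul_eq_zero.1 this).resolve_left (by positivity)

omit [Fintype σ] in
theorem eval_of_isHomogeneous_zero {p : MvPolynomial σ ℝ} (hp : p.IsHomogeneous 0)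
    (x y : σ → ℝ) : eval x p = eval y p := by
  rw [← totalDegree_zero_iff_isHomogeneous, totalDegree_eq_zero_iff_eq_C] at hp
  rw [hp, eval_C, eval_C]

omit [Fintype σ] in
theorem eq_zero_of_isHomogeneous_zero {p : MvPolynomial σ ℝ} (hp : p.IsHomogeneous 0)
    {x : σ → ℝ} (h : eval x p = 0) : p = 0 := by
  rw [← totalDegree_zero_iff_isHomogeneous, totalDegree_eq_zero_iff_eq_C] at hp
  rw [hp, eval_C] at h
  rw [hp, h, C_0]

end Derivatives

/-! ### Restriction of polynomials to lines -/

section Lines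

variable {σ A : Type*} [CommRing A] [Algebra ℝ A]

/-- The restriction `t ↦ f (z + t w)` of a polynomial to a line. -/
noncomputable def lineRestrict (z w : σ → A) (f : MvPolynomial σ ℝ) : Polynomial A :=
  aeval (fun i => Polynomial.C (z i) + Polynomial.C (w i) * Polynomial.X) f

theorem eval_lineRestrict (z w : σ → A) (f : MvPolynomial σ ℝ) (t : A) :
    (lineRestrict z w f).eval t = aeval (fun i => z i + t * w i) f := by
  unfold lineRestrict
  induction f using MvPolynomial.induction_on with
  | C a => simp [Polynomial.algebraMap_apply]
  | add p q hp hq => simp [hp, hq]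
  | mul_X p i hp => simp [hp, mul_comm t]

theorem derivative_lineRestrict [Fintype σ] (z : σ → A) (a : σ → ℝ) (f : MvPolynomial σ ℝ) :
    Polynomial.derivative (lineRestrict z (fun i => algebraMap ℝ A (a i)) f) =
      lineRestrict z (fun i => algebraMap ℝ A (a i)) (dirDeriv a f) := by
  classical
  unfold lineRestrict
  induction f using MvPolynomial.induction_on with
  | C a => simp [dirDeriv, Polynomial.algebraMap_apply]
  | add p q hp hq => simp [hp, hq, dirDeriv_add]
  | mul_X p i hp =>
    have h : dirDeriv a (p * X i) = dirDeriv a p * X i + a i • p := by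
      simp only [dirDeriv, Derivation.leibniz, pderiv_X, smul_add, Finset.sum_add_distrib,
        Pi.single_apply]
      rw [add_comm, Finset.sum_mul]
      congr 1
      · exact Finset.sum_congr rfl fun j _ => by rw [smul_eq_mul, smul_mul_assoc, mul_comm]
      · rw [Finset.sum_eq_single i]
        · simp
        · intro j _ hj; simp [hj.symm]
        · simp
    rw [h, map_mul, Polynomial.derivative_mul, hp, map_add, map_mul, map_smul, aeval_X,
      Algebra.smul_def, Polynomial.algebraMap_apply]
    simp only [Polynomial.derivative_add, Polynomial.derivative_C, Polynomial.derivative_C_mul,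
      Polynomial.derivative_X, mul_one, zero_add]
    rw [mul_comm (Polynomial.C _) (aeval _ p)]

end Lines

/-! ### Stability with respect to a convex cone -/

/-- A homogeneous polynomial of degree `d` that is positive on the cone `K` and does not vanish at
the complex points with imaginary part in `K`. -/
structure IsConeStable {σ : Type*} (K : ConvexCone ℝ (σ → ℝ)) (d : ℕ) (f : MvPolynomial σ ℝ) :
    Prop where
  homogeneous : f.IsHomogeneous d
  aeval_ne_zero : ∀ x y : σ → ℝ, y ∈ K → aeval (fun i => (x i : ℂ) + y i * Complex.I) f ≠ 0
  pos : ∀ y ∈ K, 0 < eval y f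

section ConeStable

variable {σ : Type*} {K : ConvexCone ℝ (σ → ℝ)} {d : ℕ} {f : MvPolynomial σ ℝ}

theorem aeval_ofReal (f : MvPolynomial σ ℝ) (x : σ → ℝ) :
    aeval (fun i => (x i : ℂ)) f = ((eval x f : ℝ) : ℂ) := by
  have := aeval_algebraMap_apply (A := ℝ) ℂ x f
  simpa [Function.comp_def, aeval_eq_eval] using this

theorem aeval_conj (f : MvPolynomial σ ℝ) (z : σ → ℂ) :
    aeval (fun i => (starRingEnd ℂ) (z i)) f = (starRingEnd ℂ) (aeval z f) := by
  induction f using MvPolynomial.induction_on with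
  | C a => simp
  | add p q hp hq => simp [hp, hq]
  | mul_X p i hp => simp [hp]

theorem aeval_I_mul (hf : f.IsHomogeneous d) (y : σ → ℝ) :
    aeval (fun i => ((0 : ℝ) : ℂ) + y i * Complex.I) f = Complex.I ^ d * ((eval y f : ℝ) : ℂ) := by
  rw [← aeval_ofReal, ← aeval_mul_of_isHomogeneous hf]
  simp [mul_comm]

theorem eval_ne_zero_of_aeval_ne_zero (hf : f.IsHomogeneous d) {y : σ → ℝ}
    (h : aeval (fun i => ((0 : ℝ) : ℂ) + y i * Complex.I) f ≠ 0) : eval y f ≠ 0 := by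
  intro h0
  rw [aeval_I_mul hf, h0] at h
  simp at h

theorem IsConeStable.lineRestrict_eval_ne_zero (hf : IsConeStable K d f) {x y e : σ → ℝ}
    (hy : y ∈ K) (he : e ∈ K) {t : ℂ} (ht : 0 ≤ t.im) :
    aeval (fun i => ((x i : ℂ) + y i * Complex.I) + t * e i) f ≠ 0 := by
  have hK : y + t.im • e ∈ K := by
    rcases ht.eq_or_lt with h | h
    · rw [← h, zero_smul, add_zero]; exact hy
    · exact K.add_mem hy (K.smul_mem h he)
  convert hf.aeval_ne_zero (x + t.re • e) _ hK using 2
  refine congrArg _ (_root_.funext fun i => ?_)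
  simp only [Pi.add_apply, Pi.smul_apply, smul_eq_mul, Complex.ofReal_add, Complex.ofReal_mul]
  linear_combination (-(e i : ℂ)) * Complex.re_add_im t

/-- Derivatives in directions of the cone preserve stability. -/
theorem IsConeStable.dirDeriv [Fintype σ] (hf : IsConeStable K (d + 1) f) {e : σ → ℝ}
    (he : e ∈ K) : IsConeStable K d (dirDeriv e f) := by
  have hne : ∀ x y : σ → ℝ, y ∈ K →
      aeval (fun i => (x i : ℂ) + y i * Complex.I) (Blowup.dirDeriv e f) ≠ 0 := by
    intro x y hy h0
    set z : σ → ℂ := fun i => (x i : ℂ) + y i * Complex.I with hz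
    set g := lineRestrict z (fun i => algebraMap ℝ ℂ (e i)) f with hg
    have hgt : ∀ t, g.eval t = aeval (fun i => z i + t * (e i : ℂ)) f := fun t => by
      rw [hg, eval_lineRestrict]; rfl
    have hg' : g.derivative.eval 0 = 0 := by
      rw [hg, derivative_lineRestrict, eval_lineRestrict]
      simpa using h0
    -- If `g` were a constant c, homogeneity would give f(e + s z) = s^(d+1) g(1/s) = c s^(d+1) for
    -- s ≠ 0, hence for all s; at s = 0 this contradicts f(e) > 0.
    have hdeg : 0 < g.degree := by
      by_contra hd
      rw [not_lt, Polynomial.degree_le_zero_iff] at hd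
      set c := g.coeff 0
      have hconst : ∀ t, g.eval t = c := fun t => by rw [hd, Polynomial.eval_C]
      set h := lineRestrict (fun i => algebraMap ℝ ℂ (e i)) z f with hh
      have hs : ∀ s : ℂ, s ≠ 0 → h.eval s = (Polynomial.C c * Polynomial.X ^ (d + 1)).eval s := by
        intro s hs
        rw [hh, eval_lineRestrict]
        have : (fun i => algebraMap ℝ ℂ (e i) + s * z i) =
            fun i => s * (z i + s⁻¹ * (e i : ℂ)) := by
          funext i
          change (e i : ℂ) + s * z i = s * (z i + s⁻¹ * (e i : ℂ))
          rw [mul_add s (z i), mul_inv_cancel_left₀ hs, add_comm]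
        rw [this, aeval_mul_of_isHomogeneous hf.homogeneous, ← hgt, hconst, Polynomial.eval_mul,
          Polynomial.eval_C, Polynomial.eval_pow, Polynomial.eval_X, mul_comm]
      have hpoly : h = Polynomial.C c * Polynomial.X ^ (d + 1) := by
        refine Polynomial.eq_of_infinite_eval_eq _ _ ((Set.Finite.infinite_compl
          (Set.finite_singleton (0 : ℂ))).mono fun s hs' => hs s hs')
      have h0' : h.eval 0 = 0 := by rw [hpoly]; simp
      rw [hh, eval_lineRestrict] at h0'
      simp only [zero_mul, add_zero, Complex.coe_algebraMap] at h0'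
      rw [aeval_ofReal] at h0'
      exact (hf.pos e he).ne' (by exact_mod_cast h0')
    have hmem : (0 : ℂ) ∈ g.derivative.rootSet ℂ := by
      rw [Polynomial.mem_rootSet]
      refine ⟨fun h => ?_, by rw [Polynomial.coe_aeval_eq_eval]; exact hg'⟩
      rw [Polynomial.derivative_eq_zero,
        Polynomial.natDegree_eq_zero_iff_degree_le_zero] at h
      exact absurd hdeg (not_lt.2 h)
    -- Gauss–Lucas: the roots of `g` lie in the open lower half-plane, so 0 cannot be a root of its
    -- derivative.
    have hsub := Polynomial.rootSet_derivative_subset_convexHull_rootSet hdeg hmem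
    have hconv : convexHull ℝ (g.rootSet ℂ) ⊆ {t : ℂ | t.im < 0} := by
      refine convexHull_min (fun t ht => ?_) ?_
      · rw [Polynomial.mem_rootSet] at ht
        by_contra hlt
        refine hf.lineRestrict_eval_ne_zero hy he (not_lt.1 hlt) (x := x) ?_
        rw [← hgt]
        simpa using ht.2
      · exact convex_halfSpace_im_lt 0
    exact lt_irrefl _ (show (0 : ℂ).im < 0 from hconv hsub)
  have hhom := isHomogeneous_dirDeriv hf.homogeneous e
  refine ⟨hhom, hne, fun y hy => ?_⟩
  have hne' : ∀ y ∈ K, eval y (Blowup.dirDeriv e f) ≠ 0 := fun y hy =>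
    eval_ne_zero_of_aeval_ne_zero hhom (by simpa using hne 0 y hy)
  -- Euler's identity fixes the sign at `e`; the derivative has no zero on the connected set `K`, so
  -- the sign is the same throughout.
  have hpos : 0 < eval e (Blowup.dirDeriv e f) := by
    rw [eval_dirDeriv_self hf.homogeneous]
    exact mul_pos (by positivity) (hf.pos e he)
  by_contra hneg
  rw [not_lt] at hneg
  have hpre : IsPreconnected (K : Set (σ → ℝ)) := K.convex.isPreconnected
  obtain ⟨w, hw, hw0⟩ := hpre.intermediate_value hy he (MvPolynomial.continuous_eval _).continuousOn
    ⟨hneg, hpos.le⟩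
  exact hne' w hw hw0

theorem IsConeStable.foldr_dirDeriv [Fintype σ] (l : List (σ → ℝ)) (hl : ∀ a ∈ l, a ∈ K)
    (hf : IsConeStable K (d + l.length) f) : IsConeStable K d (l.foldr Blowup.dirDeriv f) := by
  induction l generalizing d with
  | nil => exact hf
  | cons a l ih =>
    rw [List.foldr_cons]
    refine IsConeStable.dirDeriv (ih (fun b hb => hl b (List.mem_cons_of_mem _ hb)) ?_)
      (hl a List.mem_cons_self)
    rwa [List.length_cons, add_comm l.length, ← add_assoc] at hf

end ConeStable

/-! ### Real-rootedness and log-concavity -/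

section LogConcave

/-- A convex set that avoids `r` lies on one side of it, and `Real.log`, being log |x|, is concave
on each half-line. -/
theorem concaveOn_log_sub (r : ℝ) {s : Set ℝ} (hs : Convex ℝ s) (hr : r ∉ s) :
    ConcaveOn ℝ s fun t => Real.log (t - r) := by
  have hside : (∀ t ∈ s, r < t) ∨ ∀ t ∈ s, t < r := by
    by_contra! h
    obtain ⟨⟨a, ha, har⟩, b, hb, hbr⟩ := h
    exact hr (hs.ordConnected.out ha hb ⟨har, hbr⟩)
  refine ⟨hs, fun a ha b hb α β hα hβ hαβ => ?_⟩
  have hcomb : α • a + β • b - r = α • (a - r) + β • (b - r) := by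
    simp only [smul_eq_mul]
    linear_combination r * hαβ
  simp only [hcomb]
  rcases hside with h | h
  · exact strictConcaveOn_log_Ioi.concaveOn.2 (sub_pos.2 (h a ha)) (sub_pos.2 (h b hb)) hα hβ hαβ
  · exact strictConcaveOn_log_Iio.concaveOn.2 (sub_neg.2 (h a ha)) (sub_neg.2 (h b hb)) hα hβ hαβ

/-- Up to a constant, log |p(t)| is the sum of log |t - r| over the roots r. -/
theorem concaveOn_log_eval_of_splits {p : Polynomial ℝ} (hp : p.Splits) {s : Set ℝ}
    (hs : Convex ℝ s) (h0 : ∀ t ∈ s, p.eval t ≠ 0) :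
    ConcaveOn ℝ s fun t => Real.log (p.eval t) := by
  have key : ∀ m : Multiset ℝ, (∀ r ∈ m, r ∉ s) →
      ConcaveOn ℝ s fun t => Real.log ((m.map fun r => t - r).prod) := by
    intro m
    induction m using Multiset.induction_on with
    | empty => intro _; simpa using concaveOn_const (0 : ℝ) hs
    | cons a m ih =>
      intro h
      have h1 := (concaveOn_log_sub a hs (h a (Multiset.mem_cons_self a m))).add
        (ih fun r hr => h r (Multiset.mem_cons_of_mem hr))
      refine h1.congr fun t ht => ?_
      simp only [Multiset.map_cons, Multiset.prod_cons, Pi.add_apply]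
      rw [Real.log_mul]
      · intro h2
        exact h a (Multiset.mem_cons_self a m) (by rwa [← sub_eq_zero.1 h2])
      · intro h2
        rw [Multiset.prod_eq_zero_iff, Multiset.mem_map] at h2
        obtain ⟨r, hr, hr'⟩ := h2
        exact h r (Multiset.mem_cons_of_mem hr) (by rwa [← sub_eq_zero.1 hr'])
  by_cases hne : p = 0
  · subst hne
    simpa using concaveOn_const (0 : ℝ) hs
  have heval : ∀ t, p.eval t = p.leadingCoeff * (p.roots.map fun r => t - r).prod := by
    intro t
    conv_lhs => rw [hp.eq_prod_roots]
    simp [Polynomial.eval_multiset_prod, Multiset.map_map]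
  have h1 := key p.roots fun r hr hrs => h0 r hrs (Polynomial.isRoot_of_mem_roots hr)
  refine (h1.add_const (Real.log p.leadingCoeff)).congr fun t ht => ?_
  have h2 := h0 t ht
  rw [heval] at h2 ⊢
  simp only [Pi.add_apply]
  rw [Real.log_mul (left_ne_zero_of_mul h2) (right_ne_zero_of_mul h2), add_comm]

/-- Every irreducible factor has a complex root; that root must be real, so the factor is linear. -/
theorem splits_of_aeval_ne_zero {p : Polynomial ℝ}
    (h : ∀ t : ℂ, t.im ≠ 0 → Polynomial.aeval t p ≠ 0) : p.Splits := by
  by_cases hp : p = 0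
  · subst hp; exact Polynomial.Splits.zero
  obtain ⟨u, hu⟩ := UniqueFactorizationMonoid.factors_prod hp
  rw [← hu]
  refine (Polynomial.Splits.multisetProd fun q hqm => ?_).mul u.isUnit.splits
  have hq := UniqueFactorizationMonoid.irreducible_of_factor q hqm
  obtain ⟨t, ht⟩ := IsAlgClosed.exists_aeval_eq_zero ℂ q
    (Polynomial.degree_pos_of_irreducible hq).ne'
  have hpt : Polynomial.aeval t p = 0 := by
    obtain ⟨r, rfl⟩ := UniqueFactorizationMonoid.dvd_of_mem_factors hqm
    simp [ht]
  have him : t.im = 0 := by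
    by_contra h1
    exact h t h1 hpt
  have hre : q.IsRoot t.re := by
    have h2 : ((t.re : ℝ) : ℂ) = t := Complex.ext (by simp) (by simp [him])
    rw [← h2] at ht
    have h3 := Polynomial.aeval_algebraMap_apply ℂ t.re q
    rw [Complex.coe_algebraMap, ht, Polynomial.coe_aeval_eq_eval] at h3
    exact_mod_cast h3.symm
  exact Polynomial.Splits.of_degree_eq_one
    (Polynomial.degree_eq_one_of_irreducible_of_root hq hre)

variable {σ : Type*} {K : ConvexCone ℝ (σ → ℝ)} {d : ℕ} {f : MvPolynomial σ ℝ}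

theorem IsConeStable.aeval_add_mul_ne_zero (hf : IsConeStable K d f) {a x : σ → ℝ} (ha : a ∈ K)
    {t : ℂ} (ht : t.im ≠ 0) : aeval (fun i => (x i : ℂ) + t * a i) f ≠ 0 := by
  have key : ∀ s : ℂ, 0 < s.im → aeval (fun i => (x i : ℂ) + s * a i) f ≠ 0 := by
    intro s hs
    convert hf.aeval_ne_zero (x + s.re • a) _ (K.smul_mem hs ha) using 2
    refine congrArg _ (_root_.funext fun i => ?_)
    simp only [Pi.add_apply, Pi.smul_apply, smul_eq_mul, Complex.ofReal_add, Complex.ofReal_mul]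
    linear_combination (-(a i : ℂ)) * Complex.re_add_im s
  -- The lower half-plane reduces to the upper one by conjugation, the coefficients being real.
  rcases lt_or_gt_of_ne ht with h | h
  · have h1 := key ((starRingEnd ℂ) t) (by simpa using h)
    intro h0
    apply h1
    have h2 := aeval_conj f fun i => (x i : ℂ) + t * a i
    rw [h0, map_zero] at h2
    simpa using h2
  · exact key t h

/-- By homogeneity a + t x can be replaced by x + t⁻¹ a, and t⁻¹ is non-real with t. -/
theorem IsConeStable.aeval_add_mul_ne_zero' (hf : IsConeStable K d f) {a x : σ → ℝ} (ha : a ∈ K)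
    {t : ℂ} (ht : t.im ≠ 0) : aeval (fun i => (a i : ℂ) + t * x i) f ≠ 0 := by
  have ht0 : t ≠ 0 := by rintro rfl; simp at ht
  have h1 : (fun i => (a i : ℂ) + t * x i) = fun i => t * ((x i : ℂ) + t⁻¹ * a i) := by
    funext i
    rw [mul_add, mul_inv_cancel_left₀ ht0, add_comm]
  rw [h1, aeval_mul_of_isHomogeneous hf.homogeneous]
  refine mul_ne_zero (pow_ne_zero _ ht0) (hf.aeval_add_mul_ne_zero ha ?_)
  rw [Complex.inv_im]
  exact div_ne_zero (neg_ne_zero.2 ht) (by simpa using ht0)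

theorem aeval_lineRestrict (f : MvPolynomial σ ℝ) (a x : σ → ℝ) (t : ℂ) :
    Polynomial.aeval t (lineRestrict a x f) = aeval (fun i => (a i : ℂ) + t * x i) f := by
  unfold lineRestrict
  induction f using MvPolynomial.induction_on with
  | C a => simp
  | add p q hp hq => rw [map_add, map_add, hp, hq, map_add]
  | mul_X p i hp =>
    rw [map_mul, map_mul, hp, map_mul, aeval_X, aeval_X]
    simp [mul_comm t]

/-- A stable polynomial is real-rooted along lines through the cone. -/
theorem IsConeStable.splits_lineRestrict (hf : IsConeStable K d f) {a : σ → ℝ} (ha : a ∈ K)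
    (x : σ → ℝ) : (lineRestrict a x f).Splits := by
  refine splits_of_aeval_ne_zero fun t ht => ?_
  rw [aeval_lineRestrict]
  exact hf.aeval_add_mul_ne_zero' ha ht

/-- Concavity is tested on segments, where the restriction is real-rooted and positive. -/
theorem IsConeStable.concaveOn_log (hf : IsConeStable K d f) :
    ConcaveOn ℝ (K : Set (σ → ℝ)) fun x => Real.log (eval x f) := by
  refine ⟨K.convex, fun a ha b hb α β hα hβ hαβ => ?_⟩
  have hev : ∀ t, (lineRestrict a (b - a) f).eval t = eval (fun i => a i + t * (b i - a i)) f := by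
    intro t
    rw [eval_lineRestrict]
    rfl
  have hmem : ∀ t ∈ Set.Icc (0 : ℝ) 1, (fun i => a i + t * (b i - a i)) ∈ K := by
    intro t ht
    have := K.convex ha hb (sub_nonneg.2 ht.2) ht.1 (by ring)
    have h1 : (fun i => a i + t * (b i - a i)) = (1 - t) • a + t • b := by
      funext i
      simp only [Pi.add_apply, Pi.smul_apply, smul_eq_mul]
      ring
    rw [h1]
    exact this
  have h1 := concaveOn_log_eval_of_splits (hf.splits_lineRestrict ha (b - a))
    (convex_Icc (0 : ℝ) 1) fun t ht => by rw [hev]; exact (hf.pos _ (hmem t ht)).ne'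
  have h2 := h1.2 (Set.left_mem_Icc.2 zero_le_one) (Set.right_mem_Icc.2 zero_le_one) hα hβ hαβ
  simp only [hev, smul_eq_mul, mul_zero, mul_one, zero_mul, add_zero, one_mul, zero_add,
    add_sub_cancel] at h2
  have h3 : (fun i => a i + β * (b i - a i)) = α • a + β • b := by
    funext i
    simp only [Pi.add_apply, Pi.smul_apply, smul_eq_mul]
    linear_combination (-(a i)) * hαβ
  rw [h3] at h2
  exact h2

end LogConcave

/-! ### Quadratic forms with one positive direction -/

section QuadraticForms

variable {σ : Type*} [Fintype σ]

theorem dotProduct_mulVec_comm {H : Matrix σ σ ℝ} (hH : Hᵀ = H) (x y : σ → ℝ) :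
    x ⬝ᵥ H *ᵥ y = y ⬝ᵥ H *ᵥ x := by
  rw [dotProduct_mulVec, ← mulVec_transpose, hH, dotProduct_comm]

/-- For a form that is positive at `e` and negative semidefinite on the complement of `e`, an
isotropic vector of the complement lies in the kernel. -/
theorem dotProduct_mulVec_eq_zero_of_isotropic {H : Matrix σ σ ℝ} (hH : Hᵀ = H) {e : σ → ℝ}
    (he : 0 < e ⬝ᵥ H *ᵥ e) (hneg : ∀ x, x ⬝ᵥ H *ᵥ e = 0 → x ⬝ᵥ H *ᵥ x ≤ 0) {x : σ → ℝ}
    (hxe : x ⬝ᵥ H *ᵥ e = 0) (hxx : x ⬝ᵥ H *ᵥ x = 0) (y : σ → ℝ) : x ⬝ᵥ H *ᵥ y = 0 := by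
  set c := (y ⬝ᵥ H *ᵥ e) / (e ⬝ᵥ H *ᵥ e) with hc
  set w := y - c • e with hw
  have hwe : w ⬝ᵥ H *ᵥ e = 0 := by
    rw [hw, sub_dotProduct, smul_dotProduct, hc, smul_eq_mul, div_mul_cancel₀ _ he.ne', sub_self]
  have hxw : x ⬝ᵥ H *ᵥ w = x ⬝ᵥ H *ᵥ y := by
    rw [hw, mulVec_sub, mulVec_smul, dotProduct_sub, dotProduct_smul, hxe, smul_zero, sub_zero]
  rw [← hxw]
  set β := x ⬝ᵥ H *ᵥ w with hβ
  set γ := w ⬝ᵥ H *ᵥ w with hγ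
  have key : ∀ t : ℝ, 2 * t * β + t ^ 2 * γ ≤ 0 := by
    intro t
    have h1 := hneg (x + t • w) (by rw [add_dotProduct, smul_dotProduct, hxe, hwe]; simp)
    rw [mulVec_add, mulVec_smul, dotProduct_add, add_dotProduct, add_dotProduct, smul_dotProduct,
      dotProduct_smul, smul_dotProduct, dotProduct_smul, hxx, dotProduct_mulVec_comm hH w x,
      ← hβ, ← hγ] at h1
    simp only [smul_eq_mul] at h1
    linarith
  by_contra hne
  have hm : 0 < 1 + |γ| := by positivity
  -- For small t of the sign of β the linear term dominates; this t makes the left side t² (2 (1 +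
  -- |γ|) + γ) > 0.
  have h1 := key (β / (1 + |γ|))
  have h2 : 2 * (β / (1 + |γ|)) * β + (β / (1 + |γ|)) ^ 2 * γ =
      (β / (1 + |γ|)) ^ 2 * (2 * (1 + |γ|) + γ) := by
    field_simp
  rw [h2] at h1
  have h3 : 0 < 2 * (1 + |γ|) + γ := by
    have := neg_abs_le γ
    have := abs_nonneg γ
    linarith
  have h4 : 0 < (β / (1 + |γ|)) ^ 2 := by
    have := div_ne_zero hne hm.ne'
    positivity
  exact absurd h1 (not_le.2 (mul_pos h4 h3))

variable [DecidableEq σ]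

theorem dotProduct_mulVec_eigenvectorBasis {H : Matrix σ σ ℝ} (hA : H.IsHermitian) (x : σ → ℝ)
    (j : σ) : x ⬝ᵥ H *ᵥ (hA.eigenvectorBasis j : σ → ℝ) =
      hA.eigenvalues j * (x ⬝ᵥ (hA.eigenvectorBasis j : σ → ℝ)) := by
  rw [hA.mulVec_eigenvectorBasis, dotProduct_smul, smul_eq_mul]

theorem eigenvectorBasis_dotProduct {H : Matrix σ σ ℝ} (hA : H.IsHermitian) (i j : σ) :
    (hA.eigenvectorBasis i : σ → ℝ) ⬝ᵥ (hA.eigenvectorBasis j : σ → ℝ) =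
      if i = j then 1 else 0 := by
  have h := orthonormal_iff_ite.1 hA.eigenvectorBasis.orthonormal i j
  rw [← h, EuclideanSpace.inner_eq_star_dotProduct, dotProduct_comm]
  simp

/-- Some eigenvalue is positive because the form is positive at `e`. Two would span a plane on which
the form is positive definite, and such a plane meets the complement of `e`, where the form is
non-positive. -/
theorem isLorentzianMatrix_of_form {H : Matrix σ σ ℝ} (hH : Hᵀ = H) (hdet : H.det ≠ 0)
    {e : σ → ℝ} (he : 0 < e ⬝ᵥ H *ᵥ e) (hneg : ∀ x, x ⬝ᵥ H *ᵥ e = 0 → x ⬝ᵥ H *ᵥ x ≤ 0) :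
    IsLorentzianMatrix H := by
  have hA : H.IsHermitian := by rw [IsHermitian, conjTranspose_eq_transpose_of_trivial, hH]
  refine ⟨hA, hdet, ?_⟩
  have hex : ∃ i, 0 < hA.eigenvalues i := by
    by_contra! hle
    have hps : (-H).PosSemidef := by
      have h1 : -H = (hA.eigenvectorUnitary : Matrix σ σ ℝ) *
          diagonal (fun i => -hA.eigenvalues i) * (hA.eigenvectorUnitary : Matrix σ σ ℝ)ᴴ := by
        conv_lhs => rw [hA.spectral_theorem, Unitary.conjStarAlgAut_apply]
        rw [← diagonal_neg, Matrix.mul_neg, Matrix.neg_mul]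
        rfl
      rw [h1]
      exact (PosSemidef.diagonal fun i => neg_nonneg.2 (hle i)).mul_mul_conjTranspose_same _
    have h2 := hps.re_dotProduct_nonneg e
    simp only [star_trivial, neg_mulVec, dotProduct_neg, RCLike.re_to_real] at h2
    linarith
  obtain ⟨i, hi⟩ := hex
  refine ⟨i, hi, fun j hj => ?_⟩
  by_contra hij
  set u : σ → ℝ := (hA.eigenvectorBasis i).ofLp with hu
  set w : σ → ℝ := (hA.eigenvectorBasis j).ofLp with hw
  have huu : u ⬝ᵥ H *ᵥ u = hA.eigenvalues i := by
    rw [dotProduct_mulVec_eigenvectorBasis, eigenvectorBasis_dotProduct]; simp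
  have hww : w ⬝ᵥ H *ᵥ w = hA.eigenvalues j := by
    rw [dotProduct_mulVec_eigenvectorBasis, eigenvectorBasis_dotProduct]; simp
  have huw : u ⬝ᵥ H *ᵥ w = 0 := by
    rw [dotProduct_mulVec_eigenvectorBasis, eigenvectorBasis_dotProduct]; simp [Ne.symm hij]
  have hwu : w ⬝ᵥ H *ᵥ u = 0 := by rw [dotProduct_mulVec_comm hH, huw]
  set a := w ⬝ᵥ H *ᵥ e with ha
  set b := u ⬝ᵥ H *ᵥ e with hb
  -- This combination is H-orthogonal to `e`, so a² λ_i + b² λ_j ≤ 0. Hence a = 0, which puts `w`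
  -- itself into the complement of `e`.
  have h1 := hneg (a • u - b • w) (by
    rw [sub_dotProduct, smul_dotProduct, smul_dotProduct, ← ha, ← hb, smul_eq_mul, smul_eq_mul,
      mul_comm, sub_self])
  rw [mulVec_sub, mulVec_smul, mulVec_smul, dotProduct_sub, sub_dotProduct, sub_dotProduct] at h1
  simp only [smul_dotProduct, dotProduct_smul, huu, hww, huw, hwu, smul_eq_mul] at h1
  have ha0 : a = 0 := by
    have h2 : a ^ 2 * hA.eigenvalues i ≤ 0 := by
      nlinarith [mul_nonneg (sq_nonneg b) hj.le]
    have h3 : a ^ 2 ≤ 0 := by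
      by_contra h
      exact absurd h2 (not_le.2 (mul_pos (not_le.1 h) hi))
    exact pow_eq_zero_iff two_ne_zero |>.1 (le_antisymm h3 (sq_nonneg a))
  have h4 := hneg w (ha.symm.trans ha0)
  rw [hww] at h4
  exact absurd hj (not_lt.2 h4)

end QuadraticForms

/-! ### Hessians of derivatives of stable polynomials -/

section Hessians

variable {σ : Type*} [Fintype σ] {K : ConvexCone ℝ (σ → ℝ)} {d : ℕ} {f q : MvPolynomial σ ℝ}

theorem dotProduct_hessian_mulVec (q : MvPolynomial σ ℝ) (x y : σ → ℝ) :
    x ⬝ᵥ hessian q *ᵥ y = eval 0 (dirDeriv x (dirDeriv y q)) := by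
  rw [dirDeriv.eq_def y q, dirDeriv_sum, map_sum]
  simp only [dirDeriv, Derivation.map_smul, smul_eval, map_sum, dotProduct, mulVec, hessian, of_apply,
    Finset.mul_sum]
  rw [Finset.sum_comm]
  exact Finset.sum_congr rfl fun i _ => Finset.sum_congr rfl fun j _ => by ring

omit [Fintype σ] in
theorem transpose_hessian (q : MvPolynomial σ ℝ) : (hessian q)ᵀ = hessian q := by
  ext i j
  simp [hessian, pderiv_comm i j]

theorem dotProduct_hessian_mulVec_self (hq : q.IsHomogeneous 2) (x : σ → ℝ) :
    x ⬝ᵥ hessian q *ᵥ x = 2 * eval x q := by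
  have h1 := isHomogeneous_dirDeriv hq x
  rw [dotProduct_hessian_mulVec, eval_of_isHomogeneous_zero (isHomogeneous_dirDeriv h1 x) 0 x,
    eval_dirDeriv_self h1, eval_dirDeriv_self hq]
  simp

/-- The reversed Cauchy-Schwarz inequality for stable quadratic forms. -/
theorem IsConeStable.hessian_mul_le (hq : IsConeStable K 2 q) {e : σ → ℝ} (he : e ∈ K)
    (x : σ → ℝ) : (x ⬝ᵥ hessian q *ᵥ x) * (e ⬝ᵥ hessian q *ᵥ e) ≤ (x ⬝ᵥ hessian q *ᵥ e) ^ 2 := by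
  have hA : 0 < e ⬝ᵥ hessian q *ᵥ e := by
    rw [dotProduct_hessian_mulVec_self hq.homogeneous]
    exact mul_pos two_pos (hq.pos e he)
  set A := e ⬝ᵥ hessian q *ᵥ e with hAdef
  set B := x ⬝ᵥ hessian q *ᵥ e with hB
  set C' := x ⬝ᵥ hessian q *ᵥ x with hC
  have hpoly : Polynomial.C 2 * lineRestrict x e q =
      Polynomial.C C' + Polynomial.C (2 * B) * Polynomial.X + Polynomial.C A * Polynomial.X ^ 2 := by
    refine Polynomial.funext fun t => ?_
    have h1 := dotProduct_hessian_mulVec_self hq.homogeneous (x + t • e)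
    rw [mulVec_add, mulVec_smul, dotProduct_add, add_dotProduct, add_dotProduct, smul_dotProduct,
      dotProduct_smul, smul_dotProduct, dotProduct_smul,
      dotProduct_mulVec_comm (transpose_hessian q) e x, ← hC, ← hB, ← hAdef] at h1
    simp only [smul_eq_mul] at h1
    rw [Polynomial.eval_mul, Polynomial.eval_C, eval_lineRestrict]
    have h2 : aeval (fun i => x i + t * e i) q = eval (x + t • e) q := rfl
    rw [h2, ← h1]
    simp
    ring
  by_contra hlt
  rw [not_le] at hlt
  set D := C' * A - B ^ 2 with hD
  have hDpos : 0 < D := by linarith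
  -- If the inequality fails, A t² + 2 B t + C' has negative discriminant; this is its non-real
  -- root, which stability forbids.
  set t : ℂ := ((-B / A : ℝ) : ℂ) + ((√D / A : ℝ) : ℂ) * Complex.I with ht
  have him : t.im ≠ 0 := by
    have : t.im = √D / A := by simp [ht]
    rw [this]
    exact (div_pos (Real.sqrt_pos.2 hDpos) hA).ne'
  apply hq.aeval_add_mul_ne_zero he (x := x) him
  rw [← aeval_lineRestrict]
  have h3 := congrArg (Polynomial.aeval t) hpoly
  simp only [map_mul, map_add, map_pow, Polynomial.aeval_C, Polynomial.aeval_X,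
    Complex.coe_algebraMap] at h3
  have hAC : (A : ℂ) ≠ 0 := by exact_mod_cast hA.ne'
  have hAt : (A : ℂ) * t = -B + √D * Complex.I := by
    rw [ht]
    push_cast
    field_simp
  have hsq : ((√D : ℝ) : ℂ) ^ 2 = C' * A - B ^ 2 := by
    rw [← Complex.ofReal_pow, Real.sq_sqrt hDpos.le, hD]
    push_cast
    ring
  have h4 : (C' : ℂ) + ((2 : ℝ) : ℂ) * B * t + A * t ^ 2 = 0 := by
    apply mul_left_cancel₀ hAC
    push_cast
    linear_combination (A * t + B + √D * Complex.I) * hAt + hsq * Complex.I ^ 2 +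
      (C' * A - B ^ 2) * Complex.I_sq
  rw [h4] at h3
  simpa using h3

theorem IsConeStable.hessian_pos (hq : IsConeStable K 2 q) {e : σ → ℝ} (he : e ∈ K) :
    0 < e ⬝ᵥ hessian q *ᵥ e := by
  rw [dotProduct_hessian_mulVec_self hq.homogeneous]
  exact mul_pos two_pos (hq.pos e he)

theorem IsConeStable.hessian_nonpos (hq : IsConeStable K 2 q) {e : σ → ℝ} (he : e ∈ K)
    (x : σ → ℝ) (hx : x ⬝ᵥ hessian q *ᵥ e = 0) : x ⬝ᵥ hessian q *ᵥ x ≤ 0 := by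
  have h := hq.hessian_mul_le he x
  rw [hx] at h
  by_contra hlt
  have := mul_pos (not_le.1 hlt) (hq.hessian_pos he)
  linarith

omit [Fintype σ] in
-- Thus, up to scaling, every vector is a difference of two elements of an open cone.
theorem exists_sub_smul_mem (hK : IsOpen (K : Set (σ → ℝ))) {e : σ → ℝ} (he : e ∈ K)
    (z : σ → ℝ) : ∃ δ : ℝ, 0 < δ ∧ e - δ • z ∈ K := by
  have hc : Continuous fun δ : ℝ => e - δ • z := by fun_prop
  have h0 : (fun δ : ℝ => e - δ • z) ⁻¹' (K : Set (σ → ℝ)) ∈ 𝓝 (0 : ℝ) :=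
    (hK.preimage hc).mem_nhds (by simpa using he)
  obtain ⟨ε, hε, hball⟩ := Metric.mem_nhds_iff.1 h0
  refine ⟨ε / 2, by positivity, hball ?_⟩
  rw [Metric.mem_ball, Real.dist_eq, sub_zero, abs_of_pos (by positivity)]
  linarith

/-- For a stable cubic, the kernel of the Hessian of the derivative in a direction of the cone does
not depend on the direction. -/
theorem IsConeStable.dirDeriv_exchange (hK : IsOpen (K : Set (σ → ℝ))) (hf : IsConeStable K 3 f)
    {e z x : σ → ℝ} (he : e ∈ K) (hz : z ∈ K)
    (hx : Blowup.dirDeriv x (Blowup.dirDeriv e f) = 0) :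
    Blowup.dirDeriv x (Blowup.dirDeriv z f) = 0 := by
  have hform : ∀ w y : σ → ℝ, x ⬝ᵥ hessian (Blowup.dirDeriv w f) *ᵥ y =
      eval 0 (Blowup.dirDeriv w (Blowup.dirDeriv y (Blowup.dirDeriv x f))) := by
    intro w y
    rw [dotProduct_hessian_mulVec, dirDeriv_comm y w, dirDeriv_comm x w, dirDeriv_comm x y]
  have hxe : ∀ w, x ⬝ᵥ hessian (Blowup.dirDeriv w f) *ᵥ e = 0 := by
    intro w
    rw [hform, dirDeriv_comm e x, hx, dirDeriv_zero, map_zero]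
  have hle : ∀ w ∈ K, x ⬝ᵥ hessian (Blowup.dirDeriv w f) *ᵥ x ≤ 0 := fun w hw =>
    (hf.dirDeriv hw).hessian_nonpos he x (hxe w)
  -- The number D_w D_x D_x f is linear in w, non-positive on `K` and zero at `e`. Its value at e -
  -- δ z ∈ K is then -δ times that at `z`, so it vanishes at `z` as well.
  obtain ⟨δ, hδ, hmem⟩ := exists_sub_smul_mem hK he z
  have h1 := hle _ hmem
  have h0 : x ⬝ᵥ hessian (Blowup.dirDeriv e f) *ᵥ x = 0 := by
    rw [dotProduct_mulVec, ← mulVec_transpose, transpose_hessian, dotProduct_comm,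
      dotProduct_hessian_mulVec, hx, dirDeriv_zero, map_zero]
  rw [hform, sub_eq_add_neg, ← neg_smul, add_dirDeriv, smul_dirDeriv, map_add, smul_eval,
    ← hform, ← hform, h0] at h1
  have h2 := hle z hz
  have h3 : x ⬝ᵥ hessian (Blowup.dirDeriv z f) *ᵥ x = 0 := by
    by_contra hne
    have := mul_neg_of_pos_of_neg hδ (lt_of_le_of_ne h2 hne)
    linarith
  have hquad := hf.dirDeriv hz
  -- Now `x` is isotropic for the Hessian of D_z f and orthogonal to `e`, hence in its kernel.
  have h4 := dotProduct_mulVec_eq_zero_of_isotropic (transpose_hessian _) (hquad.hessian_pos he)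
    (hquad.hessian_nonpos he) (hxe z) h3
  have hlin := isHomogeneous_dirDeriv hquad.homogeneous x
  refine eq_zero_of_forall_dirDeriv_eq_zero hlin fun a =>
    eq_zero_of_isHomogeneous_zero (isHomogeneous_dirDeriv hlin a) (x := 0) ?_
  rw [dirDeriv_comm, ← dotProduct_hessian_mulVec]
  exact h4 a

theorem eq_zero_of_forall_mem_dirDeriv_eq_zero (hK : IsOpen (K : Set (σ → ℝ)))
    (hne : (K : Set (σ → ℝ)).Nonempty) (hf : f.IsHomogeneous (d + 1))
    (h : ∀ z ∈ K, dirDeriv z f = 0) : f = 0 := by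
  obtain ⟨e, he⟩ := hne
  refine eq_zero_of_forall_dirDeriv_eq_zero hf fun a => ?_
  obtain ⟨δ, hδ, hmem⟩ := exists_sub_smul_mem hK he a
  have h1 := h _ hmem
  rw [sub_eq_add_neg, ← neg_smul, add_dirDeriv, smul_dirDeriv, h e he, zero_add] at h1
  exact (smul_eq_zero.1 h1).resolve_left (neg_ne_zero.2 hδ.ne')

/-- The kernel of the Hessian of an iterated derivative of order `d - 2` in directions of the cone
consists of the directions in which the polynomial is constant. -/
theorem IsConeStable.dirDeriv_eq_zero_of_foldr (hK : IsOpen (K : Set (σ → ℝ)))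
    (hne : (K : Set (σ → ℝ)).Nonempty) (l : List (σ → ℝ)) (hl : ∀ a ∈ l, a ∈ K)
    (hf : IsConeStable K (l.length + 2) f) {x : σ → ℝ}
    (hx : Blowup.dirDeriv x (l.foldr Blowup.dirDeriv f) = 0) : Blowup.dirDeriv x f = 0 := by
  induction l generalizing f with
  | nil => exact hx
  | cons e l ih =>
    have hl' : ∀ a ∈ l, a ∈ K := fun a ha => hl a (List.mem_cons_of_mem _ ha)
    have hf' : IsConeStable K (l.length + 2 + 1) f := by
      rwa [List.length_cons, add_right_comm] at hf
    have hcubic : IsConeStable K 3 (l.foldr Blowup.dirDeriv f) := by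
      refine IsConeStable.foldr_dirDeriv l hl' ?_
      convert hf' using 1
      omega
    refine eq_zero_of_forall_mem_dirDeriv_eq_zero hK hne
      (isHomogeneous_dirDeriv hf'.homogeneous x) fun z hz => ?_
    -- Trading the direction `e` for an arbitrary `z` in the cone lets the induction hypothesis
    -- apply to D_z f.
    have h1 := hcubic.dirDeriv_exchange hK (hl e List.mem_cons_self) hz hx
    rw [dirDeriv_foldr_comm z] at h1
    rw [dirDeriv_comm]
    exact ih hl' (hf'.dirDeriv hz) h1

theorem IsConeStable.isLorentzianMatrix_hessian [DecidableEq σ] (hK : IsOpen (K : Set (σ → ℝ)))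
    {e : σ → ℝ} (he : e ∈ K) (l : List (σ → ℝ)) (hl : ∀ a ∈ l, a ∈ K)
    (hf : IsConeStable K (l.length + 2) f) (hker : ∀ x, Blowup.dirDeriv x f = 0 → x = 0) :
    IsLorentzianMatrix (hessian (l.foldr Blowup.dirDeriv f)) := by
  have hq : IsConeStable K 2 (l.foldr Blowup.dirDeriv f) :=
    IsConeStable.foldr_dirDeriv l hl (by rwa [add_comm])
  refine isLorentzianMatrix_of_form (transpose_hessian _) (fun hdet => ?_) (hq.hessian_pos he)
    (hq.hessian_nonpos he)
  obtain ⟨x, hx0, hx⟩ := exists_mulVec_eq_zero_iff.2 hdet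
  refine hx0 (hker x (hf.dirDeriv_eq_zero_of_foldr hK ⟨e, he⟩ l hl ?_))
  have hlin := isHomogeneous_dirDeriv hq.homogeneous x
  refine eq_zero_of_forall_dirDeriv_eq_zero hlin fun a =>
    eq_zero_of_isHomogeneous_zero (isHomogeneous_dirDeriv hlin a) (x := 0) ?_
  rw [← dotProduct_hessian_mulVec, hx, dotProduct_zero]

end Hessians

/-! ### Determinants of pencils c + Δ_w A with A positive semidefinite -/

section Matrices

variable {V : Type*} [Fintype V] [DecidableEq V]

open scoped MatrixOrder in
theorem exists_transpose_mul_self {A : Matrix V V ℝ} (hA : A.PosSemidef) :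
    ∃ B : Matrix V V ℝ, A = Bᵀ * B := by
  obtain ⟨B, hB⟩ := CStarAlgebra.nonneg_iff_eq_star_mul_self.mp hA.nonneg
  exact ⟨B, by rw [hB, star_eq_conjTranspose, conjTranspose_eq_transpose_of_trivial]⟩

/-- The products XY and YX have the same characteristic polynomial. With A = BᵀB this turns Δ_w A
into the symmetric matrix B Δ_w Bᵀ. -/
theorem det_diagonal_add_mul_comm {R : Type*} [CommRing R] (c : R) (X Y : Matrix V V R) :
    (diagonal (fun _ => c) + X * Y).det = (diagonal (fun _ => c) + Y * X).det := by
  have h := congrArg (Polynomial.eval c) (charpoly_mul_comm (-X) Y)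
  rw [eval_charpoly, eval_charpoly, Matrix.neg_mul, Matrix.mul_neg, sub_neg_eq_add,
    sub_neg_eq_add] at h
  exact h

theorem isHermitian_conj_diagonal (B : Matrix V V ℝ) (w : V → ℝ) (c : ℝ) :
    (diagonal (fun _ => c) + B * (diagonal w * Bᵀ)).IsHermitian := by
  rw [IsHermitian, conjTranspose_eq_transpose_of_trivial, transpose_add, transpose_mul,
    transpose_mul, diagonal_transpose, diagonal_transpose, transpose_transpose, Matrix.mul_assoc]

theorem det_pencil_pos {A : Matrix V V ℝ} (hA : A.PosSemidef) {c : ℝ} (hc : 0 < c) {w : V → ℝ}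
    (hw : ∀ v, 0 < w v) : 0 < (diagonal (fun _ => c) + diagonal w * A).det := by
  obtain ⟨B, rfl⟩ := exists_transpose_mul_self hA
  rw [← Matrix.mul_assoc, det_diagonal_add_mul_comm]
  refine PosDef.det_pos ((PosDef.diagonal fun _ => hc).add_posSemidef ?_)
  have h := (PosSemidef.diagonal (n := V) (d := w) fun v => (hw v).le).mul_mul_conjTranspose_same B
  rwa [conjTranspose_eq_transpose_of_trivial, Matrix.mul_assoc] at h

/-- For `A` positive semidefinite, the determinant of `2 z₀ + Δ_z A` does not vanish if `z` has
positive imaginary parts and `z₀` is a nonzero number with non-negative imaginary part. -/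
theorem det_pencil_ne_zero {A : Matrix V V ℝ} (hA : A.PosSemidef) {c : ℂ} (hc : 0 ≤ c.im)
    (hc0 : c ≠ 0) {w : V → ℂ} (hw : ∀ v, 0 < (w v).im) :
    (diagonal (fun _ => c) + diagonal w * A.map (algebraMap ℝ ℂ)).det ≠ 0 := by
  intro hdet
  obtain ⟨u, hu0, hu⟩ := exists_vecMul_eq_zero_iff.2 hdet
  obtain ⟨B, rfl⟩ := exists_transpose_mul_self hA
  have hw0 : ∀ v, w v ≠ 0 := fun v h => by have := hw v; rw [h] at this; simp at this
  set p : V → ℂ := fun v => u v * w v with hp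
  have hpu : u ᵥ* diagonal w = p := by
    funext v
    rw [vecMul_diagonal]
  rw [vecMul_add, ← vecMul_vecMul, hpu, Matrix.map_mul, ← vecMul_vecMul] at hu
  set r := p ᵥ* (Bᵀ).map (algebraMap ℝ ℂ) with hr
  have hstar : star p ᵥ* (Bᵀ).map (algebraMap ℝ ℂ) = star r := by
    funext v
    simp [hr, vecMul, dotProduct]
  -- Pairing the left kernel vector u with the conjugate of p = u Δ_w gives c ∑ |u_v|² conj(w_v) +
  -- |r|² = 0, where r = p Bᵀ.
  have h1 : c * (u ⬝ᵥ star p) + r ⬝ᵥ star r = 0 := by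
    have h2 := congrArg (fun x => x ⬝ᵥ star p) hu
    simp only [add_dotProduct, zero_dotProduct] at h2
    have h3 : u ᵥ* diagonal (fun _ => c) = c • u := by
      funext v
      rw [vecMul_diagonal, Pi.smul_apply, smul_eq_mul, mul_comm]
    rw [h3, smul_dotProduct, ← dotProduct_mulVec, ← vecMul_transpose, ← transpose_map, hstar] at h2
    exact h2
  have h4 : r ⬝ᵥ star r = ((∑ v, ‖r v‖ ^ 2 : ℝ) : ℂ) := by
    simp only [dotProduct, Pi.star_apply, RCLike.star_def, Complex.mul_conj, Complex.normSq_eq_norm_sq]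
    push_cast
    rfl
  have h5 : u ⬝ᵥ star p = ∑ v, ((‖u v‖ ^ 2 : ℝ) : ℂ) * (starRingEnd ℂ) (w v) := by
    simp only [dotProduct, hp, Pi.star_apply, star_mul', RCLike.star_def, ← mul_assoc,
      Complex.mul_conj, Complex.normSq_eq_norm_sq]
  have him : (u ⬝ᵥ star p).im < 0 := by
    rw [h5, Complex.im_sum]
    have : ∀ v, (((‖u v‖ ^ 2 : ℝ) : ℂ) * (starRingEnd ℂ) (w v)).im = -(‖u v‖ ^ 2 * (w v).im) := by
      intro v
      rw [Complex.im_ofReal_mul, Complex.conj_im, mul_neg]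
    simp only [this, Finset.sum_neg_distrib, neg_lt_zero]
    obtain ⟨v, hv⟩ := Function.ne_iff.1 hu0
    exact Finset.sum_pos' (fun v _ => mul_nonneg (sq_nonneg _) (hw v).le)
      ⟨v, Finset.mem_univ v, mul_pos (pow_pos (norm_pos_iff.2 hv) 2) (hw v)⟩
  set S := ∑ v, ‖r v‖ ^ 2 with hS
  have hS0 : 0 ≤ S := Finset.sum_nonneg fun v _ => sq_nonneg _
  rw [h4] at h1
  -- The left side has negative imaginary part, whereas -S / c has non-negative imaginary part since
  -- S ≥ 0 and Im c ≥ 0.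
  have h6 : u ⬝ᵥ star p = (-S : ℝ) * c⁻¹ := by
    apply mul_left_cancel₀ hc0
    push_cast
    field_simp
    linear_combination h1
  rw [h6, Complex.im_ofReal_mul, Complex.inv_im] at him
  have h7 : 0 ≤ -S * (-c.im / Complex.normSq c) := by
    rw [neg_div, neg_mul_neg]
    exact mul_nonneg hS0 (div_nonneg hc (Complex.normSq_nonneg c))
  exact absurd him (not_lt.2 h7)

/-- By hypothesis all eigenvalues of the symmetric matrix c + B Δ_w Bᵀ are zero, so the matrix is
zero. As B is invertible, Δ_w A = -c; the nonzero off-diagonal entries of A force w = 0, and then c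
= 0. -/
theorem eq_zero_of_det_pencil {A : Matrix V V ℝ} (hA : A.PosDef)
    (hoff : ∀ v, ∃ u, u ≠ v ∧ A v u ≠ 0) [Nonempty V] {c : ℝ} {w : V → ℝ}
    (h : ∀ s : ℝ, (diagonal (fun _ => s + c) + diagonal w * A).det = s ^ Fintype.card V) :
    c = 0 ∧ w = 0 := by
  obtain ⟨B, hB⟩ := exists_transpose_mul_self hA.posSemidef
  have hH := isHermitian_conj_diagonal B w c
  have hcomm : ∀ s : ℝ, (diagonal (fun _ => s) + diagonal w * A).det =
      (diagonal (fun _ => s) + B * (diagonal w * Bᵀ)).det := fun s => by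
    rw [hB, ← Matrix.mul_assoc, det_diagonal_add_mul_comm]
  have hev : hH.eigenvalues = 0 := by
    funext i
    have h1 := h (-hH.eigenvalues i)
    have h2 : (diagonal (fun _ => -hH.eigenvalues i + c) + diagonal w * A).det = 0 := by
      rw [hcomm, ← exists_mulVec_eq_zero_iff]
      refine ⟨(hH.eigenvectorBasis i).ofLp, fun h0 => ?_, ?_⟩
      · exact hH.eigenvectorBasis.orthonormal.ne_zero i (WithLp.ofLp_injective 2 h0)
      · have h3 := hH.mulVec_eigenvectorBasis i
        have h4 : diagonal (fun _ : V => -hH.eigenvalues i + c) + B * (diagonal w * Bᵀ) =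
            -(hH.eigenvalues i • (1 : Matrix V V ℝ)) +
              (diagonal (fun _ => c) + B * (diagonal w * Bᵀ)) := by
          rw [← add_assoc, ← diagonal_add, smul_one_eq_diagonal, diagonal_neg]
        rw [h4, add_mulVec, h3, neg_mulVec, smul_mulVec, one_mulVec]
        exact neg_add_cancel _
    rw [h2] at h1
    have := pow_eq_zero_iff (Fintype.card_ne_zero (α := V)) |>.1 h1.symm
    simpa using this
  rw [hH.eigenvalues_eq_zero_iff] at hev
  have hBdet : IsUnit B.det := by
    have h1 := hA.det_pos
    rw [hB, det_mul, det_transpose] at h1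
    exact isUnit_iff_ne_zero.2 fun h0 => by rw [h0] at h1; simp at h1
  have hdiag : diagonal w * A = diagonal fun _ => -c := by
    have h1 : B * (diagonal w * Bᵀ) = diagonal fun _ => -c := by
      rw [← neg_eq_of_add_eq_zero_right hev, diagonal_neg]
    have h2 : B * (diagonal w * A) = B * diagonal fun _ => -c := by
      rw [hB, ← Matrix.mul_assoc (diagonal w), ← Matrix.mul_assoc, h1, ← smul_one_eq_diagonal,
        Matrix.smul_mul, Matrix.one_mul, Matrix.mul_smul, Matrix.mul_one]
    have h3 := congrArg (fun M => B⁻¹ * M) h2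
    simpa only [nonsing_inv_mul_cancel_left _ _ hBdet] using h3
  have hw : w = 0 := by
    funext v
    obtain ⟨u, huv, hAu⟩ := hoff v
    have h1 := congrFun (congrFun hdiag v) u
    rw [diagonal_mul, diagonal_apply_ne _ huv.symm] at h1
    exact (mul_eq_zero.1 h1).resolve_right hAu
  refine ⟨?_, hw⟩
  obtain ⟨v⟩ := (inferInstance : Nonempty V)
  have h1 := congrFun (congrFun hdiag v) v
  rw [hw, diagonal_mul, diagonal_apply_eq] at h1
  simpa using h1.symm

end Matrices

/-! ### Polynomials depending continuously on a parameter -/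

section CoeffContinuous

variable {σ ι : Type*}

/-- All coefficients of a polynomial depend continuously on a parameter. -/
def CoeffContinuous (P : ℝ → MvPolynomial σ ℝ) : Prop :=
  ∀ m, Continuous fun ε => (P ε).coeff m

theorem CoeffContinuous.const (p : MvPolynomial σ ℝ) : CoeffContinuous fun _ => p :=
  fun _ => continuous_const

theorem CoeffContinuous.C {c : ℝ → ℝ} (hc : Continuous c) :
    CoeffContinuous fun ε => (MvPolynomial.C (c ε) : MvPolynomial σ ℝ) := by
  classical
  intro m
  simp only [coeff_C]
  split_ifs
  · exact hc
  · exact continuous_const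

theorem CoeffContinuous.add {P Q : ℝ → MvPolynomial σ ℝ} (hP : CoeffContinuous P)
    (hQ : CoeffContinuous Q) : CoeffContinuous fun ε => P ε + Q ε := by
  intro m
  simp only [coeff_add]
  exact (hP m).add (hQ m)

theorem CoeffContinuous.mul {P Q : ℝ → MvPolynomial σ ℝ} (hP : CoeffContinuous P)
    (hQ : CoeffContinuous Q) : CoeffContinuous fun ε => P ε * Q ε := by
  classical
  intro m
  simp only [coeff_mul]
  exact continuous_finsetSum _ fun x _ => (hP x.1).mul (hQ x.2)

theorem CoeffContinuous.smul {P : ℝ → MvPolynomial σ ℝ} (hP : CoeffContinuous P) (c : ℝ) :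
    CoeffContinuous fun ε => c • P ε := by
  intro m
  simp only [coeff_smul]
  exact (hP m).const_smul c

theorem CoeffContinuous.sum {P : ι → ℝ → MvPolynomial σ ℝ} (s : Finset ι)
    (hP : ∀ i ∈ s, CoeffContinuous (P i)) : CoeffContinuous fun ε => ∑ i ∈ s, P i ε := by
  intro m
  simp only [coeff_sum]
  exact continuous_finsetSum _ fun i hi => hP i hi m

theorem CoeffContinuous.prod {P : ι → ℝ → MvPolynomial σ ℝ} (s : Finset ι)
    (hP : ∀ i ∈ s, CoeffContinuous (P i)) : CoeffContinuous fun ε => ∏ i ∈ s, P i ε := by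
  classical
  induction s using Finset.induction_on with
  | empty => simpa using CoeffContinuous.const 1
  | insert i s hi ih =>
    simp only [Finset.prod_insert hi]
    exact (hP i (Finset.mem_insert_self i s)).mul
      (ih fun j hj => hP j (Finset.mem_insert_of_mem hj))

theorem CoeffContinuous.det [Fintype ι] [DecidableEq ι]
    {M : ℝ → Matrix ι ι (MvPolynomial σ ℝ)} (hM : ∀ i j, CoeffContinuous fun ε => M ε i j) :
    CoeffContinuous fun ε => (M ε).det := by
  simp only [det_apply']
  exact CoeffContinuous.sum _ fun τ _ => (CoeffContinuous.const _).mul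
    (CoeffContinuous.prod _ fun i _ => hM _ _)

theorem CoeffContinuous.dirDeriv [Fintype σ] {P : ℝ → MvPolynomial σ ℝ} (hP : CoeffContinuous P)
    (a : σ → ℝ) : CoeffContinuous fun ε => Blowup.dirDeriv a (P ε) := by
  refine CoeffContinuous.sum _ fun i _ => CoeffContinuous.smul (fun m => ?_) _
  simp only [coeff_pderiv]
  exact (hP _).mul continuous_const

theorem CoeffContinuous.foldr_dirDeriv [Fintype σ] {P : ℝ → MvPolynomial σ ℝ}
    (hP : CoeffContinuous P) (l : List (σ → ℝ)) :
    CoeffContinuous fun ε => l.foldr Blowup.dirDeriv (P ε) := by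
  induction l with
  | nil => exact hP
  | cons a l ih => exact ih.dirDeriv a

theorem CoeffContinuous.continuous_eval [Fintype σ] {P : ℝ → MvPolynomial σ ℝ} {d : ℕ}
    (hP : CoeffContinuous P) (hd : ∀ ε, (P ε).IsHomogeneous d) (x : σ → ℝ) :
    Continuous fun ε => eval x (P ε) := by
  classical
  -- The support may vary with ε; homogeneity provides one finite index set for all ε.
  have h : ∀ ε, eval x (P ε) = ∑ m ∈ Finset.finsuppAntidiag Finset.univ d,
      (P ε).coeff m * ∏ i, x i ^ m i := by
    intro ε
    rw [eval_eq']
    refine Finset.sum_subset (fun m hm => ?_) fun m _ hm => ?_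
    · rw [Finset.mem_finsuppAntidiag]
      refine ⟨?_, Finset.subset_univ _⟩
      rw [← Finsupp.degree_eq_sum]
      by_contra hne
      exact (mem_support_iff.1 hm) ((hd ε).coeff_eq_zero hne)
    · rw [notMem_support_iff.1 hm, zero_mul]
  simp only [h]
  exact continuous_finsetSum _ fun m _ => (hP m).mul continuous_const

end CoeffContinuous

/-! ### The perturbed determinant is strictly Lorentzian -/

section Perturbation

variable {σ V : Type*} [Fintype σ] [Fintype V] [DecidableEq V]

/-- The linear form `z_i + ε ∑ j, z_j`. -/
noncomputable def perturbedVar (ε : ℝ) (i : σ) : MvPolynomial σ ℝ :=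
  X i + C ε * ∑ j, X j

/-- The matrix `2 z₀ + Δ_z (A + ε)`, composed with the substitution `z_i ↦ z_i + ε ∑ j, z_j`. -/
noncomputable def perturbedPencil (A : Matrix V V ℝ) (ε : ℝ) :
    Matrix V V (MvPolynomial (Option V) ℝ) :=
  diagonal (fun _ => C 2 * perturbedVar ε none) +
    diagonal (fun v => perturbedVar ε (some v)) *
      (A + ε • (1 : Matrix V V ℝ)).map (fun a => (C a : MvPolynomial (Option V) ℝ))

theorem perturbedPencil_apply (A : Matrix V V ℝ) (ε : ℝ) (i j : V) :
    perturbedPencil A ε i j = (if i = j then C 2 * perturbedVar ε none else 0) +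
      perturbedVar ε (some i) * C (A i j + ε * (1 : Matrix V V ℝ) i j) := by
  rw [perturbedPencil, Matrix.add_apply, diagonal_mul, diagonal_apply]
  rfl

/-- The determinant of `2 z₀ + Δ_z (A + ε)`, composed with the substitution
`z_i ↦ z_i + ε ∑ j, z_j`. -/
noncomputable def perturbedPoly (A : Matrix V V ℝ) (ε : ℝ) : MvPolynomial (Option V) ℝ :=
  (perturbedPencil A ε).det

/-- The open convex cone of the points at which all forms `z_i + ε ∑ j, z_j` are positive. -/
def perturbedCone (σ : Type*) [Fintype σ] (ε : ℝ) : ConvexCone ℝ (σ → ℝ) where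
  carrier := {y | ∀ i, 0 < y i + ε * ∑ j, y j}
  smul_mem' c hc y hy i := by
    have := mul_pos hc (hy i)
    simp only [Pi.smul_apply, smul_eq_mul, ← Finset.mul_sum]
    linarith
  add_mem' x hx y hy i := by
    have := add_pos (hx i) (hy i)
    simp only [Pi.add_apply, Finset.sum_add_distrib]
    linarith

theorem mem_perturbedCone {ε : ℝ} {y : σ → ℝ} :
    y ∈ perturbedCone σ ε ↔ ∀ i, 0 < y i + ε * ∑ j, y j := Iff.rfl

theorem isOpen_perturbedCone (ε : ℝ) : IsOpen (perturbedCone σ ε : Set (σ → ℝ)) := by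
  have : (perturbedCone σ ε : Set (σ → ℝ)) = ⋂ i, {y | 0 < y i + ε * ∑ j, y j} := by
    ext y
    simp only [Set.mem_iInter]
    exact mem_perturbedCone
  rw [this]
  exact isOpen_iInter_of_finite fun i => isOpen_lt continuous_const (by fun_prop)

theorem mem_perturbedCone_of_pos {ε : ℝ} (hε : 0 ≤ ε) {y : σ → ℝ} (hy : ∀ i, 0 < y i) :
    y ∈ perturbedCone σ ε := fun i =>
  add_pos_of_pos_of_nonneg (hy i) (mul_nonneg hε (Finset.sum_nonneg fun j _ => (hy j).le))

theorem mem_perturbedCone_of_nonneg {ε : ℝ} (hε : 0 < ε) {y : σ → ℝ} (hy : ∀ i, 0 ≤ y i)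
    (hy0 : y ≠ 0) : y ∈ perturbedCone σ ε := fun i => by
  obtain ⟨j, hj⟩ := Function.ne_iff.1 hy0
  have hsum : 0 < ∑ j, y j :=
    Finset.sum_pos' (fun j _ => hy j) ⟨j, Finset.mem_univ j, lt_of_le_of_ne (hy j) hj.symm⟩
  exact add_pos_of_nonneg_of_pos (hy i) (mul_pos hε hsum)

theorem aeval_perturbedVar {B : Type*} [CommRing B] [Algebra ℝ B] (ε : ℝ) (i : σ) (z : σ → B) :
    aeval z (perturbedVar ε i) = z i + algebraMap ℝ B ε * ∑ j, z j := by
  simp [perturbedVar]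

theorem aeval_perturbedPoly {B : Type*} [CommRing B] [Algebra ℝ B] (A : Matrix V V ℝ) (ε : ℝ)
    (z : Option V → B) : aeval z (perturbedPoly A ε) =
      (diagonal (fun _ => 2 * (z none + algebraMap ℝ B ε * ∑ j, z j)) +
        diagonal (fun v => z (some v) + algebraMap ℝ B ε * ∑ j, z j) *
          (A + ε • (1 : Matrix V V ℝ)).map (algebraMap ℝ B)).det := by
  unfold perturbedPoly
  rw [AlgHom.map_det]
  congr 1
  ext i j
  rw [AlgHom.mapMatrix_apply, map_apply, perturbedPencil_apply, Matrix.add_apply, diagonal_mul,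
    map_add, map_mul, aeval_perturbedVar, aeval_C, diagonal_apply]
  congr 1
  split_ifs
  · rw [map_mul, aeval_perturbedVar, aeval_C, map_ofNat]
  · rw [map_zero]

theorem isHomogeneous_perturbedVar (ε : ℝ) (i : σ) :
    (perturbedVar ε i : MvPolynomial σ ℝ).IsHomogeneous 1 :=
  (isHomogeneous_X _ i).add ((IsHomogeneous.sum _ _ 1 fun j _ => isHomogeneous_X _ j).C_mul ε)

theorem isHomogeneous_perturbedPoly (A : Matrix V V ℝ) (ε : ℝ) :
    (perturbedPoly A ε).IsHomogeneous (Fintype.card V) := by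
  unfold perturbedPoly
  rw [det_apply']
  refine IsHomogeneous.sum _ _ _ fun τ _ => ?_
  have h1 : (∏ i, perturbedPencil A ε (τ i) i).IsHomogeneous (∑ _i : V, 1) := by
    refine IsHomogeneous.prod _ _ _ fun i _ => ?_
    rw [perturbedPencil_apply]
    refine IsHomogeneous.add ?_ ?_
    · split_ifs
      · exact (isHomogeneous_perturbedVar ε none).C_mul 2
      · exact isHomogeneous_zero _ _ _
    · rw [mul_comm]
      exact (isHomogeneous_perturbedVar ε _).C_mul _
  rw [Finset.sum_const, Finset.card_univ, smul_eq_mul, mul_one] at h1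
  have h2 : (((Equiv.Perm.sign τ : ℤˣ) : ℤ) : MvPolynomial (Option V) ℝ) =
      C (((Equiv.Perm.sign τ : ℤˣ) : ℤ) : ℝ) := by simp
  rw [h2]
  exact h1.C_mul _

theorem coeffContinuous_perturbedVar (i : σ) :
    CoeffContinuous fun ε => (perturbedVar ε i : MvPolynomial σ ℝ) :=
  (CoeffContinuous.const _).add ((CoeffContinuous.C continuous_id).mul (CoeffContinuous.const _))

theorem coeffContinuous_perturbedPoly (A : Matrix V V ℝ) : CoeffContinuous (perturbedPoly A) := by
  refine CoeffContinuous.det fun i j => ?_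
  simp only [perturbedPencil_apply]
  refine CoeffContinuous.add ?_ ((coeffContinuous_perturbedVar _).mul
    (CoeffContinuous.C (by fun_prop)))
  split_ifs
  · exact (CoeffContinuous.const _).mul (coeffContinuous_perturbedVar _)
  · exact CoeffContinuous.const _

omit [Fintype V] in
theorem posSemidef_add_smul_one {A : Matrix V V ℝ} (hA : A.PosSemidef) {ε : ℝ} (hε : 0 ≤ ε) :
    (A + ε • (1 : Matrix V V ℝ)).PosSemidef :=
  hA.add (PosSemidef.one.smul hε)

theorem isConeStable_perturbedPoly {A : Matrix V V ℝ} (hA : A.PosSemidef) {ε : ℝ} (hε : 0 ≤ ε) :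
    IsConeStable (perturbedCone (Option V) ε) (Fintype.card V) (perturbedPoly A ε) where
  homogeneous := isHomogeneous_perturbedPoly A ε
  aeval_ne_zero x y hy := by
    have him : ∀ i, (((x i : ℂ) + y i * Complex.I) +
        algebraMap ℝ ℂ ε * ∑ j, ((x j : ℂ) + y j * Complex.I)).im = y i + ε * ∑ j, y j := by
      intro i
      simp
    have him' : ∀ i, 0 < (((x i : ℂ) + y i * Complex.I) +
        algebraMap ℝ ℂ ε * ∑ j, ((x j : ℂ) + y j * Complex.I)).im := by
      intro i
      rw [him]
      exact hy i
    have h2 : 0 < (2 * (((x none : ℂ) + y none * Complex.I) +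
        algebraMap ℝ ℂ ε * ∑ j, ((x j : ℂ) + y j * Complex.I))).im := by
      have h3 := him' none
      rw [show (2 : ℂ) = ((2 : ℝ) : ℂ) by simp, Complex.im_ofReal_mul]
      positivity
    rw [aeval_perturbedPoly]
    refine det_pencil_ne_zero (posSemidef_add_smul_one hA hε) h2.le (fun h => ?_) fun v =>
      him' (some v)
    rw [h] at h2
    simp at h2
  pos y hy := by
    have h := aeval_perturbedPoly (B := ℝ) A ε y
    have hid : (A + ε • (1 : Matrix V V ℝ)).map (algebraMap ℝ ℝ) = A + ε • 1 := by
      ext i j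
      simp
    rw [aeval_eq_eval, hid] at h
    refine lt_of_lt_of_eq ?_ h.symm
    exact det_pencil_pos (posSemidef_add_smul_one hA hε) (mul_pos two_pos (hy none)) fun v =>
      hy (some v)

/-- A vanishing derivative makes the polynomial invariant under translation by `x`. Translating the
points where the pencil is s times the identity brings `eq_zero_of_det_pencil` into play; the
substitution z_i + ε ∑ z_j is invertible, so `x` itself vanishes. -/
theorem eq_zero_of_dirDeriv_perturbedPoly [Nontrivial V] {A : Matrix V V ℝ} (hA : A.PosSemidef)
    (hoff : ∀ v u, u ≠ v → A v u ≠ 0) {ε : ℝ} (hε : 0 < ε) {x : Option V → ℝ}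
    (hx : dirDeriv x (perturbedPoly A ε) = 0) : x = 0 := by
  have hPD : (A + ε • (1 : Matrix V V ℝ)).PosDef := PosDef.posSemidef_add hA (PosDef.one.smul hε)
  set n : ℝ := (Fintype.card (Option V) : ℝ) with hn
  have hn0 : 0 ≤ n := Nat.cast_nonneg _
  have hden : 0 < 1 + n * ε := by positivity
  have hid : (A + ε • (1 : Matrix V V ℝ)).map (RingHom.id ℝ) = A + ε • 1 := by
    ext i j
    simp
  have hline : ∀ y : Option V → ℝ, aeval (fun i => y i + 1 * x i) (perturbedPoly A ε) =
      aeval (fun i => y i + 0 * x i) (perturbedPoly A ε) := by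
    intro y
    have h1 := derivative_lineRestrict y x (perturbedPoly A ε)
    rw [hx] at h1
    have h2 : Polynomial.derivative (lineRestrict y x (perturbedPoly A ε)) = 0 := by
      refine h1.trans ?_
      simp [lineRestrict]
    rw [Polynomial.derivative_eq_zero, Polynomial.natDegree_eq_zero] at h2
    obtain ⟨c, hc⟩ := h2
    rw [← eval_lineRestrict, ← eval_lineRestrict, ← hc, Polynomial.eval_C, Polynomial.eval_C]
  have hkey := eq_zero_of_det_pencil hPD (c := 2 * (x none + ε * ∑ j, x j))
    (w := fun v => x (some v) + ε * ∑ j, x j) (fun v => ?_) fun s => ?_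
  · obtain ⟨h0, hsome⟩ := hkey
    have h1 : ∀ i, x i = -(ε * ∑ j, x j) := by
      intro i
      cases i with
      | none => linarith
      | some v =>
        have := congrFun hsome v
        simp only [Pi.zero_apply] at this
        linarith
    have h2 : ∑ j, x j = n * -(ε * ∑ j, x j) := by
      conv_lhs => rw [Finset.sum_congr rfl fun i _ => h1 i]
      rw [Finset.sum_const, Finset.card_univ, nsmul_eq_mul]
    have h3 : (1 + n * ε) * ∑ j, x j = 0 := by linarith
    have h4 := (mul_eq_zero.1 h3).resolve_left hden.ne'
    funext i
    rw [h1 i, h4]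
    simp
  · obtain ⟨u, hu⟩ := exists_ne v
    refine ⟨u, hu, ?_⟩
    simp [one_apply_ne hu.symm, hoff v u hu]
  -- The point y is the preimage of (s/2, 0, …, 0) under the substitution: its coordinates sum to t,
  -- and adding ε t to each gives s/2 at `none` and 0 elsewhere.
  · set t := s / 2 / (1 + n * ε) with ht
    have hts : t * (1 + n * ε) = s / 2 := div_mul_cancel₀ _ hden.ne'
    set y : Option V → ℝ := fun i => (if i = none then s / 2 else 0) - ε * t with hy
    have hsum : ∑ j, y j = t := by
      rw [hy, Finset.sum_sub_distrib, Finset.sum_ite_eq' Finset.univ none, Finset.sum_const,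
        Finset.card_univ, nsmul_eq_mul, ← hn]
      simp only [Finset.mem_univ, if_true]
      linarith
    have h1 := hline y
    simp only [zero_mul, add_zero, one_mul, aeval_perturbedPoly, hid, Finset.sum_add_distrib, hsum,
      Algebra.algebraMap_self, RingHom.id_apply] at h1
    have h2 : y none + ε * t = s / 2 := by simp [hy]
    have h3 : ∀ v, y (some v) + ε * t = 0 := fun v => by simp [hy]
    have h4 : 2 * (y none + x none + ε * (t + ∑ j, x j)) =
        s + 2 * (x none + ε * ∑ j, x j) := by linarith
    have h5 : ∀ v, y (some v) + x (some v) + ε * (t + ∑ j, x j) =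
        x (some v) + ε * ∑ j, x j := fun v => by linarith [h3 v]
    simp only [h2, h3, h4, h5] at h1
    rw [h1]
    simp [mul_div_cancel₀]

/-- Differentiating m_i times in each variable leaves a positive multiple of the coefficient of z^m,
and this constant is positive because it is again cone-stable. -/
theorem coeff_pos_of_isConeStable [DecidableEq σ] {K : ConvexCone ℝ (σ → ℝ)}
    (hK : ∀ i, Pi.single i 1 ∈ K) (hne : (K : Set (σ → ℝ)).Nonempty) {d : ℕ}
    {f : MvPolynomial σ ℝ} (hf : IsConeStable K d f) (m : σ →₀ ℕ) (hm : ∑ i, m i = d) :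
    0 < f.coeff m := by
  induction d generalizing f m with
  | zero =>
    obtain ⟨e, he⟩ := hne
    have h1 := hf.pos e he
    have h2 := hf.homogeneous
    rw [← totalDegree_zero_iff_isHomogeneous, totalDegree_eq_zero_iff_eq_C] at h2
    rw [h2, eval_C] at h1
    have h3 : m = 0 := by
      ext i
      exact (Finset.sum_eq_zero_iff.1 hm) i (Finset.mem_univ i)
    rwa [h3]
  | succ d ih =>
    obtain ⟨i, -, hi⟩ : ∃ i ∈ Finset.univ, m i ≠ 0 :=
      Finset.exists_ne_zero_of_sum_ne_zero (by omega)
    have hmi : m - Finsupp.single i 1 + Finsupp.single i 1 = m :=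
      tsub_add_cancel_of_le (Finsupp.single_le_iff.2 (Nat.one_le_iff_ne_zero.2 hi))
    have h1 : ∑ j, (m - Finsupp.single i 1 : σ →₀ ℕ) j = d := by
      have h2 : ∑ j, (m - Finsupp.single i 1 + Finsupp.single i 1 : σ →₀ ℕ) j = d + 1 := by rw [hmi, hm]
      simp only [Finsupp.add_apply, Finset.sum_add_distrib, Finsupp.single_apply,
        Finset.sum_ite_eq, Finset.mem_univ, if_true] at h2
      omega
    have h2 := ih (hf.dirDeriv (hK i)) _ h1
    rw [single_dirDeriv, coeff_pderiv, hmi] at h2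
    exact pos_of_mul_pos_left h2 (by positivity)

theorem isStrictlyLorentzian_perturbedPoly {A : Matrix V V ℝ} (hA : A.PosSemidef)
    (hoff : ∀ v u, u ≠ v → A v u ≠ 0) {ε : ℝ} (hε : 0 < ε) :
    IsStrictlyLorentzian (Fintype.card V) (perturbedPoly A ε) := by
  have hcone := isConeStable_perturbedPoly hA hε.le
  have hsingle : ∀ i, (Pi.single i 1 : Option V → ℝ) ∈ perturbedCone (Option V) ε := fun i =>
    mem_perturbedCone_of_nonneg hε (fun j => by
      rw [Pi.single_apply]; split_ifs <;> norm_num) (by simp)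
  have hone : (fun _ => 1 : Option V → ℝ) ∈ perturbedCone (Option V) ε :=
    mem_perturbedCone_of_pos hε.le fun _ => one_pos
  refine ⟨hcone.homogeneous, coeff_pos_of_isConeStable hsingle ⟨_, hone⟩ hcone, fun l hl => ?_⟩
  have : Nontrivial V := Fintype.one_lt_card_iff_nontrivial.1 (by omega)
  rw [iterPDeriv_eq_foldr_dirDeriv]
  refine IsConeStable.isLorentzianMatrix_hessian (isOpen_perturbedCone ε) hone _ (fun a ha => ?_)
    (by rwa [List.length_map, hl]) fun x hx => eq_zero_of_dirDeriv_perturbedPoly hA hoff hε hx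
  obtain ⟨i, -, rfl⟩ := List.mem_map.1 ha
  exact hsingle i

end Perturbation

/-! ### Non-negative coefficients and closure properties -/

section NonnegCoeffs

variable {σ τ ι : Type*}

theorem HasNonnegCoeffs.C {c : ℝ} (hc : 0 ≤ c) :
    HasNonnegCoeffs (MvPolynomial.C c : MvPolynomial σ ℝ) := fun m => by
  classical
  rw [coeff_C]
  split_ifs
  · exact hc
  · exact le_rfl

theorem HasNonnegCoeffs.X (i : σ) : HasNonnegCoeffs (MvPolynomial.X i : MvPolynomial σ ℝ) :=
  fun m => by
  classical
  rw [coeff_X]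
  split_ifs <;> norm_num

theorem HasNonnegCoeffs.mul {p q : MvPolynomial σ ℝ} (hp : HasNonnegCoeffs p)
    (hq : HasNonnegCoeffs q) : HasNonnegCoeffs (p * q) := fun m => by
  classical
  rw [coeff_mul]
  exact Finset.sum_nonneg fun x _ => mul_nonneg (hp _) (hq _)

theorem HasNonnegCoeffs.pow {p : MvPolynomial σ ℝ} (hp : HasNonnegCoeffs p) (n : ℕ) :
    HasNonnegCoeffs (p ^ n) := by
  induction n with
  | zero => rw [pow_zero, ← C_1]; exact HasNonnegCoeffs.C zero_le_one
  | succ n ih => rw [pow_succ]; exact ih.mul hp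

theorem HasNonnegCoeffs.sum {p : ι → MvPolynomial σ ℝ} (s : Finset ι)
    (hp : ∀ i ∈ s, HasNonnegCoeffs (p i)) : HasNonnegCoeffs (∑ i ∈ s, p i) := fun m => by
  rw [coeff_sum]
  exact Finset.sum_nonneg fun i hi => hp i hi m

theorem HasNonnegCoeffs.prod {p : ι → MvPolynomial σ ℝ} (s : Finset ι)
    (hp : ∀ i ∈ s, HasNonnegCoeffs (p i)) : HasNonnegCoeffs (∏ i ∈ s, p i) := by
  classical
  induction s using Finset.induction_on with
  | empty => rw [Finset.prod_empty, ← C_1]; exact HasNonnegCoeffs.C zero_le_one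
  | insert i s hi ih =>
    rw [Finset.prod_insert hi]
    exact (hp i (Finset.mem_insert_self i s)).mul
      (ih fun j hj => hp j (Finset.mem_insert_of_mem hj))

theorem HasNonnegCoeffs.aeval {p : MvPolynomial σ ℝ} (hp : HasNonnegCoeffs p)
    {g : σ → MvPolynomial τ ℝ} (hg : ∀ i, HasNonnegCoeffs (g i)) :
    HasNonnegCoeffs (MvPolynomial.aeval g p) := by
  rw [aeval_def, eval₂_eq]
  exact HasNonnegCoeffs.sum _ fun m _ => (HasNonnegCoeffs.C (hp m)).mul
    (HasNonnegCoeffs.prod _ fun i _ => (hg i).pow _)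

theorem HasNonnegCoeffs.dirDeriv [Fintype σ] {p : MvPolynomial σ ℝ} (hp : HasNonnegCoeffs p)
    {a : σ → ℝ} (ha : ∀ i, 0 ≤ a i) : HasNonnegCoeffs (Blowup.dirDeriv a p) :=
  HasNonnegCoeffs.sum _ fun i _ m => by
    rw [coeff_smul, coeff_pderiv, smul_eq_mul]
    exact mul_nonneg (ha i) (mul_nonneg (hp _) (by positivity))

theorem HasNonnegCoeffs.foldr_dirDeriv [Fintype σ] {p : MvPolynomial σ ℝ}
    (hp : HasNonnegCoeffs p) {l : List (σ → ℝ)} (hl : ∀ a ∈ l, ∀ i, 0 ≤ a i) :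
    HasNonnegCoeffs (l.foldr Blowup.dirDeriv p) := by
  induction l with
  | nil => exact hp
  | cons a l ih =>
    exact (ih fun b hb => hl b (List.mem_cons_of_mem _ hb)).dirDeriv (hl a List.mem_cons_self)

theorem HasNonnegCoeffs.eval_pos {p : MvPolynomial σ ℝ} (hp : HasNonnegCoeffs p) (h0 : p ≠ 0)
    {x : σ → ℝ} (hx : ∀ i, 0 < x i) : 0 < eval x p := by
  rw [eval_eq]
  obtain ⟨m, hm⟩ := support_nonempty.2 h0
  exact Finset.sum_pos' (fun m _ => mul_nonneg (hp m) (Finset.prod_nonneg fun i _ =>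
    pow_nonneg (hx i).le _)) ⟨m, hm, mul_pos (lt_of_le_of_ne (hp m) (mem_support_iff.1 hm).symm)
      (Finset.prod_pos fun i _ => pow_pos (hx i) _)⟩

theorem hasNonnegCoeffs_of_isLorentzian [Fintype σ] [DecidableEq σ] {p : MvPolynomial σ ℝ}
    (hp : IsLorentzian p) : HasNonnegCoeffs p := by
  obtain ⟨d, -, q, hq, hlim⟩ := hp
  intro m
  refine ge_of_tendsto' (hlim m) fun N => ?_
  by_cases hm : ∑ i, m i = d
  · exact ((hq N).2.1 m hm).le
  · rw [(hq N).1.coeff_eq_zero (by rwa [Finsupp.degree_eq_sum])]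

theorem isStronglyLogConcave_of_isCompletelyLogConcave [Fintype σ] {p : MvPolynomial σ ℝ}
    (hp : IsCompletelyLogConcave p) : IsStronglyLogConcave p := by
  classical
  refine ⟨hp.1, fun l => ?_⟩
  have h := hp.2 l.length (Matrix.of fun i => Pi.single (l.get i) 1) fun i j => by
    rw [of_apply, Pi.single_apply]
    split_ifs <;> norm_num
  have h1 : matrixDeriv (Matrix.of fun i => Pi.single (l.get i) 1) p = iterPDeriv l p := by
    rw [iterPDeriv_eq_foldr_dirDeriv, matrixDeriv]
    congr 1
    conv_rhs => rw [← List.ofFn_get l, List.map_ofFn]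
    rfl
  rwa [h1] at h

theorem foldr_dirDeriv_eq_zero_of_lt [Fintype σ] {p : MvPolynomial σ ℝ} {d : ℕ}
    (hp : p.IsHomogeneous d) {l : List (σ → ℝ)} (hl : d < l.length) :
    l.foldr dirDeriv p = 0 := by
  induction l generalizing p d with
  | nil => simp at hl
  | cons a l ih =>
    rw [List.foldr_cons, dirDeriv_foldr_comm]
    cases d with
    | zero => rw [dirDeriv_eq_zero_of_isHomogeneous_zero hp, foldr_dirDeriv_zero]
    | succ d => exact ih (isHomogeneous_dirDeriv hp a) (by simpa using hl)

theorem foldr_dirDeriv_eq_zero_of_mem [Fintype σ] (p : MvPolynomial σ ℝ) {l : List (σ → ℝ)}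
    (hl : (0 : σ → ℝ) ∈ l) : l.foldr dirDeriv p = 0 := by
  induction l with
  | nil => simp at hl
  | cons a l ih =>
    rw [List.foldr_cons]
    rcases List.mem_cons.1 hl with h | h
    · rw [← h, zero_dirDeriv]
    · rw [ih h, dirDeriv_zero]

theorem convex_pos (σ : Type*) : Convex ℝ {x : σ → ℝ | ∀ i, 0 < x i} := by
  have : {x : σ → ℝ | ∀ i, 0 < x i} = Set.univ.pi fun _ => Set.Ioi 0 := by
    ext x
    simp
  rw [this]
  exact convex_pi fun i _ => convex_Ioi 0

theorem concaveOn_log_of_tendsto {s : Set (σ → ℝ)} (hs : Convex ℝ s) {q : ℕ → (σ → ℝ) → ℝ}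
    {p : (σ → ℝ) → ℝ} (hq : ∀ N, ConcaveOn ℝ s fun x => Real.log (q N x))
    (hp : ∀ x ∈ s, p x ≠ 0) (hlim : ∀ x, Tendsto (fun N => q N x) atTop (𝓝 (p x))) :
    ConcaveOn ℝ s fun x => Real.log (p x) := by
  refine ⟨hs, fun a ha b hb α β hα hβ hαβ => ?_⟩
  have hlog : ∀ x ∈ s, Tendsto (fun N => Real.log (q N x)) atTop (𝓝 (Real.log (p x))) :=
    fun x hx => (hlim x).log (hp x hx)
  exact le_of_tendsto_of_tendsto' (((hlog a ha).const_smul α).add ((hlog b hb).const_smul β))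
    (hlog _ (hs ha hb hα hβ hαβ)) fun N => (hq N).2 ha hb hα hβ hαβ

end NonnegCoeffs

/-! ### The limit ε → 0 -/

section Perturbation

variable {V : Type*} [Fintype V] [DecidableEq V] {A : Matrix V V ℝ}

theorem tendsto_inv_nat_add_one : Tendsto (fun N : ℕ => 1 / ((N : ℝ) + 1)) atTop (𝓝 0) :=
  tendsto_one_div_add_atTop_nhds_zero_nat

theorem isLorentzian_perturbedPoly_zero (hA : A.PosSemidef)
    (hoff : ∀ v u, u ≠ v → A v u ≠ 0) : IsLorentzian (perturbedPoly A 0) :=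
  ⟨Fintype.card V, isHomogeneous_perturbedPoly A 0, fun N => perturbedPoly A (1 / ((N : ℝ) + 1)),
    fun _ => isStrictlyLorentzian_perturbedPoly hA hoff Nat.one_div_pos_of_nat,
    fun m => ((coeffContinuous_perturbedPoly A m).tendsto 0).comp tendsto_inv_nat_add_one⟩

theorem isCompletelyLogConcave_perturbedPoly_zero (hA : A.PosSemidef)
    (hnn : HasNonnegCoeffs (perturbedPoly A 0)) : IsCompletelyLogConcave (perturbedPoly A 0) := by
  refine ⟨hnn, fun m M hM => ?_⟩
  set l := List.ofFn M with hl
  have hlnn : ∀ a ∈ l, ∀ i, 0 ≤ a i := by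
    intro a ha
    obtain ⟨j, rfl⟩ := (List.mem_ofFn' _ _).1 ha
    exact hM j
  have hderiv : matrixDeriv M (perturbedPoly A 0) = l.foldr dirDeriv (perturbedPoly A 0) := rfl
  rw [hderiv, or_iff_not_imp_left]
  intro hne
  -- A nonzero derivative has no zero row, so for ε > 0 all rows lie in the perturbed cone and the
  -- perturbed derivative is log-concave. Non-vanishing of the limit lets the logarithms converge.
  have hl0 : (0 : Option V → ℝ) ∉ l := fun h => hne (foldr_dirDeriv_eq_zero_of_mem _ h)
  have hlen : l.length ≤ Fintype.card V := by
    by_contra h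
    exact hne (foldr_dirDeriv_eq_zero_of_lt (isHomogeneous_perturbedPoly A 0) (not_le.1 h))
  obtain ⟨d, hd⟩ := Nat.exists_eq_add_of_le' hlen
  have hhom : ∀ ε, (l.foldr dirDeriv (perturbedPoly A ε)).IsHomogeneous d := by
    intro ε
    have h := isHomogeneous_perturbedPoly A ε
    rw [hd] at h
    clear_value l
    generalize perturbedPoly A ε = f at h
    clear hlnn hderiv hne hl0 hlen hd hl
    induction l generalizing d with
    | nil => exact h
    | cons a l ih =>
      refine isHomogeneous_dirDeriv (ih (d + 1) ?_) a
      rwa [List.length_cons, add_comm l.length, ← add_assoc] at h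
  have hpos := fun (x : Option V → ℝ) (hx : ∀ i, 0 < x i) => (hnn.foldr_dirDeriv hlnn).eval_pos hne hx
  refine ⟨hpos, concaveOn_log_of_tendsto
    (q := fun N x => eval x (l.foldr dirDeriv (perturbedPoly A (1 / ((N : ℝ) + 1)))))
    (convex_pos _) (fun N => ?_) (fun x hx => (hpos x hx).ne') fun x => ?_⟩
  · have hε : (0 : ℝ) < 1 / ((N : ℝ) + 1) := Nat.one_div_pos_of_nat
    have hcone : IsConeStable (perturbedCone (Option V) (1 / ((N : ℝ) + 1))) d
        (l.foldr dirDeriv (perturbedPoly A (1 / ((N : ℝ) + 1)))) := by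
      refine IsConeStable.foldr_dirDeriv l (fun a ha => mem_perturbedCone_of_nonneg hε
        (hlnn a ha) fun h0 => hl0 (h0 ▸ ha)) ?_
      rw [← hd]
      exact isConeStable_perturbedPoly hA hε.le
    exact hcone.concaveOn_log.subset (fun x hx => mem_perturbedCone_of_pos hε.le hx)
      (convex_pos _)
  · exact ((((coeffContinuous_perturbedPoly A).foldr_dirDeriv l).continuous_eval
      hhom x).tendsto 0).comp tendsto_inv_nat_add_one

theorem isRealStable_perturbedPoly_zero (hA : A.PosSemidef) :
    IsRealStable (perturbedPoly A 0) := by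
  intro z hz
  have h := (isConeStable_perturbedPoly hA le_rfl).aeval_ne_zero (fun i => (z i).re)
    (fun i => (z i).im) fun i => by simpa using hz i
  simpa using h

end Perturbation

/-! ### Positive semidefinite modified distance matrices -/

section Graphs

variable {V : Type*} [DecidableEq V] {G : SimpleGraph V}

theorem modDistMatrix_apply (G : SimpleGraph V) (v w : V) :
    modDistMatrix G v w = G.dist v w + if v = w then 2 else 0 := by
  simp [modDistMatrix, distMatrix, diagonal_apply]

theorem isHermitian_modDistMatrix (G : SimpleGraph V) : (modDistMatrix G).IsHermitian := by
  ext v w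
  simp [modDistMatrix_apply, G.dist_comm, eq_comm]

theorem modDistMatrix_ne_zero (hG : G.Connected) {v u : V} (h : u ≠ v) :
    modDistMatrix G v u ≠ 0 := by
  rw [modDistMatrix_apply, if_neg h.symm, add_zero]
  exact_mod_cast (hG.pos_dist_of_ne h.symm).ne'

omit [DecidableEq V] in
theorem two_le_dist (hG : G.Connected) {v w : V} (h : v ≠ w) (hadj : ¬G.Adj v w) :
    2 ≤ G.dist v w := by
  have h1 := hG.pos_dist_of_ne h
  have h2 : G.dist v w ≠ 1 := fun h => hadj (SimpleGraph.dist_eq_one_iff_adj.1 h)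
  omega

theorem isCompleteMultipartite_of_posSemidef (hG : G.Connected)
    (h : (modDistMatrix G).PosSemidef) : G.IsCompleteMultipartite := by
  refine ⟨fun a b c hab hbc hac => ?_⟩
  have hba : b ≠ a := by rintro rfl; exact hbc hac
  have hbc' : b ≠ c := by rintro rfl; exact hab hac
  have h1 : (2 : ℝ) ≤ G.dist a b := by exact_mod_cast two_le_dist hG hba.symm hab
  have h2 : (2 : ℝ) ≤ G.dist b c := by exact_mod_cast two_le_dist hG hbc' hbc
  -- With d(a,c) = 1 and d(a,b), d(b,c) ≥ 2 the form is at most 12 + 2 - 16 < 0.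
  have h3 := (h.submatrix ![a, c, b]).re_dotProduct_nonneg ![1, 1, -2]
  have h4 : G.dist a c = 1 := SimpleGraph.dist_eq_one_iff_adj.2 hac
  simp [dotProduct, mulVec, Fin.sum_univ_three, modDistMatrix_apply, hac.ne, hac.ne', hba,
    hba.symm, hbc', hbc'.symm, G.dist_comm (u := c), G.dist_comm (u := b) (v := a), h4] at h3
  linarith

omit [DecidableEq V] in
theorem dist_eq_two (hG : G.Connected) (h : G.IsCompleteMultipartite) {v w : V} (hne : v ≠ w)
    (hadj : ¬G.Adj v w) : G.dist v w = 2 := by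
  refine le_antisymm ?_ (two_le_dist hG hne hadj)
  obtain ⟨p⟩ := hG.preconnected v w
  cases p with
  | nil => exact absurd rfl hne
  | @cons _ u _ hvu p =>
    -- Non-adjacency is transitive, so a neighbour u of v cannot be non-adjacent to w.
    have huw : G.Adj u w := by
      by_contra huw
      exact h.trans v w u hadj (fun h' => huw h'.symm) hvu
    exact SimpleGraph.dist_le (SimpleGraph.Walk.cons hvu (SimpleGraph.Walk.cons huw .nil))

/-- The entries are 2 within a part, diagonal included, and 1 between parts: the all-ones matrix
plus the Gram matrix of the part indicators. -/
theorem posSemidef_of_isCompleteMultipartite [Fintype V] (hG : G.Connected)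
    (h : G.IsCompleteMultipartite) : (modDistMatrix G).PosSemidef := by
  classical
  let W : Matrix (Quotient h.setoid) V ℝ :=
    Matrix.of fun q v => if Quotient.mk h.setoid v = q then 1 else 0
  have h1 : modDistMatrix G = vecMulVec 1 (star 1) + Wᴴ * W := by
    ext v w
    have h2 : (Wᴴ * W) v w = if G.Adj v w then 0 else 1 := by
      have h3 : Quotient.mk h.setoid v = Quotient.mk h.setoid w ↔ ¬G.Adj v w := Quotient.eq
      simp [mul_apply, W, h3]
    rw [Matrix.add_apply, h2, vecMulVec_apply, modDistMatrix_apply]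
    by_cases hvw : v = w
    · subst hvw
      norm_num
    · by_cases hadj : G.Adj v w
      · simp [hvw, hadj, SimpleGraph.dist_eq_one_iff_adj.2 hadj]
      · rw [dist_eq_two hG h hvw hadj]
        simp [hvw, hadj]
        norm_num
  rw [h1]
  exact (posSemidef_vecMulVec_self_star _).add (posSemidef_conjTranspose_mul_self W)

theorem posSemidef_of_det_ne_zero [Fintype V] {A : Matrix V V ℝ} (hA : A.IsHermitian)
    (h : ∀ s : ℝ, 0 < s → (diagonal (fun _ => s) + A).det ≠ 0) : A.PosSemidef := by
  rw [hA.posSemidef_iff_eigenvalues_nonneg]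
  intro i
  by_contra hneg
  refine h (-hA.eigenvalues i) (neg_pos.2 (not_le.1 hneg)) ?_
  rw [← exists_mulVec_eq_zero_iff]
  refine ⟨(hA.eigenvectorBasis i).ofLp, fun h0 => ?_, ?_⟩
  · exact hA.eigenvectorBasis.orthonormal.ne_zero i (WithLp.ofLp_injective 2 h0)
  · rw [← smul_one_eq_diagonal, add_mulVec, hA.mulVec_eigenvectorBasis, neg_smul, neg_mulVec,
      smul_mulVec, one_mulVec]
    exact neg_add_cancel _

end Graphs

/-! ### Blowup-polynomials as determinants of pencils -/

section BlowupPolynomials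

variable {V : Type*} [Fintype V] [DecidableEq V] (G : SimpleGraph V)

theorem aeval_blowupPoly {B : Type*} [CommRing B] [Algebra ℝ B] (z : V → B) :
    aeval z (blowupPoly G) =
      (diagonal (fun _ => (-2 : B)) + diagonal z * (modDistMatrix G).map (algebraMap ℝ B)).det := by
  unfold blowupPoly
  rw [AlgHom.map_det]
  congr 1
  ext i j
  rw [AlgHom.mapMatrix_apply, map_apply, Matrix.add_apply, Matrix.add_apply, diagonal_mul,
    diagonal_mul, map_apply, map_apply, map_add, map_mul, aeval_X, aeval_C, diagonal_apply,
    diagonal_apply]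
  congr 1
  split_ifs
  · rw [aeval_C, map_neg, map_ofNat]
  · rw [map_zero]

theorem eval_perturbedPoly_zero (A : Matrix V V ℝ) (z : Option V → ℝ) :
    eval z (perturbedPoly A 0) =
      (diagonal (fun _ => 2 * z none) + diagonal (fun v => z (some v)) * A).det := by
  have h := aeval_perturbedPoly A 0 z
  rw [aeval_eq_eval] at h
  refine h.trans ?_
  congr 1
  simp

theorem neg_pow_mul_aeval_blowupPoly {B : Type*} [CommRing B] [Algebra ℝ B] (z : V → B) :
    (-1) ^ Fintype.card V * aeval (fun v => -z v) (blowupPoly G) =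
      (diagonal (fun _ => (2 : B)) + diagonal z * (modDistMatrix G).map (algebraMap ℝ B)).det := by
  rw [aeval_blowupPoly, ← det_smul]
  congr 1
  ext i j
  simp only [Matrix.smul_apply, Matrix.add_apply, diagonal_mul, diagonal_apply, smul_eq_mul]
  split_ifs <;> ring

theorem homBlowupPoly_eq : homBlowupPoly G = perturbedPoly (modDistMatrix G) 0 := by
  -- The defining formula divides by z₀; the factor z₀ disposes of the points where it does not
  -- apply.
  have h : X none * (homBlowupPoly G - perturbedPoly (modDistMatrix G) 0) = 0 := by
    refine MvPolynomial.funext fun z => ?_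
    rw [map_mul, eval_X, map_zero, map_sub]
    by_cases hz : z none = 0
    · rw [hz, zero_mul]
    · rw [eval_homBlowupPoly G z hz, eval_perturbedPoly_zero, eval_blowupPoly, ← det_smul,
        mul_eq_zero]
      right
      rw [sub_eq_zero]
      congr 1
      ext i j
      simp only [Matrix.smul_apply, Matrix.add_apply, diagonal_mul, diagonal_apply, smul_eq_mul]
      have hz' : -z none ≠ 0 := neg_ne_zero.2 hz
      rw [mul_add, ← mul_assoc, mul_div_cancel₀ _ hz']
      split_ifs <;> ring
  exact sub_eq_zero.1 ((mul_eq_zero.1 h).resolve_left (X_ne_zero _))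

theorem perturbedPoly_zero_ne_zero (A : Matrix V V ℝ) : perturbedPoly A 0 ≠ 0 := by
  intro h
  have h1 := eval_perturbedPoly_zero A fun i => if i = none then 1 else 0
  rw [h] at h1
  simp at h1
  exact pow_ne_zero _ two_ne_zero h1.symm

theorem posSemidef_of_eval_ne_zero
    (h : ∀ z : Option V → ℝ, (∀ i, 0 < z i) → eval z (perturbedPoly (modDistMatrix G) 0) ≠ 0) :
    (modDistMatrix G).PosSemidef := by
  refine posSemidef_of_det_ne_zero (isHermitian_modDistMatrix G) fun s hs => ?_
  have h1 := h (fun i => if i = none then s / 2 else 1) fun i => by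
    split_ifs
    · positivity
    · exact one_pos
  rw [eval_perturbedPoly_zero] at h1
  simpa [mul_div_cancel₀] using h1

theorem aeval_reflectedBlowupPoly {B : Type*} [CommRing B] [Algebra ℝ B] (z : V → B) :
    aeval z (reflectedBlowupPoly G) =
      algebraMap ℝ B (eval (fun _ => (-1 : ℝ)) (blowupPoly G))⁻¹ *
        aeval (fun v => -z v) (blowupPoly G) := by
  rw [reflectedBlowupPoly, map_mul, aeval_C, aeval_bind₁]
  simp

theorem eval_reflectedBlowupPoly (z : V → ℝ) :
    eval z (reflectedBlowupPoly G) = (eval (fun _ => (-1 : ℝ)) (blowupPoly G))⁻¹ *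
      eval (fun v => -z v) (blowupPoly G) :=
  aeval_reflectedBlowupPoly (B := ℝ) G z

theorem eval_perturbedPoly_none_one (z : Option V → ℝ) (h : z none = 1) :
    eval z (perturbedPoly (modDistMatrix G) 0) =
      (-1) ^ Fintype.card V * eval (fun v => -z (some v)) (blowupPoly G) := by
  have h1 := neg_pow_mul_aeval_blowupPoly (B := ℝ) G fun v => z (some v)
  rw [aeval_eq_eval] at h1
  refine Eq.trans ?_ h1.symm
  rw [eval_perturbedPoly_zero, h, mul_one]
  congr 1

/-- The variable v occurs only in row v, which each term of the expansion uses once. -/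
theorem degreeOf_det_le {σ : Type*} [Fintype σ] [DecidableEq σ] (M : Matrix σ σ (MvPolynomial σ ℝ))
    (hM : ∀ v i j, degreeOf v (M i j) ≤ if i = v then 1 else 0) (v : σ) :
    degreeOf v M.det ≤ 1 := by
  rw [det_apply']
  refine (degreeOf_sum_le _ _ _).trans (Finset.sup_le fun τ _ => ?_)
  refine (degreeOf_mul_le _ _ _).trans ?_
  have h1 : degreeOf v ((((Equiv.Perm.sign τ : ℤˣ) : ℤ) : MvPolynomial σ ℝ)) = 0 := by
    have h2 : (((Equiv.Perm.sign τ : ℤˣ) : ℤ) : MvPolynomial σ ℝ) =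
        C (((Equiv.Perm.sign τ : ℤˣ) : ℤ) : ℝ) := by simp
    rw [h2, degreeOf_C]
  rw [h1, zero_add]
  refine (degreeOf_prod_le _ _ _).trans ((Finset.sum_le_sum fun i _ => hM v (τ i) i).trans ?_)
  rw [Equiv.sum_comp τ fun i => if i = v then 1 else 0]
  simp

theorem isMultiAffine_reflectedBlowupPoly : IsMultiAffine (reflectedBlowupPoly G) := by
  intro m hm v
  refine (monomial_le_degreeOf v hm).trans ?_
  rw [reflectedBlowupPoly]
  refine (degreeOf_C_mul_le _ _ _).trans ?_
  have h := aeval_blowupPoly G fun v => (-X v : MvPolynomial V ℝ)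
  rw [← aeval_eq_bind₁, h]
  refine degreeOf_det_le _ (fun v i j => ?_) v
  rw [Matrix.add_apply, diagonal_mul, map_apply, diagonal_apply]
  refine (degreeOf_add_le _ _ _).trans (max_le ?_ ?_)
  · have h2 : degreeOf v (if i = j then (-2 : MvPolynomial V ℝ) else 0) = 0 := by
      split_ifs
      · have : (-2 : MvPolynomial V ℝ) = C (-2) := by rw [C_neg, map_ofNat]
        rw [this, degreeOf_C]
      · exact degreeOf_zero v
    rw [h2]
    exact Nat.zero_le _
  · refine (degreeOf_mul_le _ _ _).trans ?_
    rw [algebraMap_eq, degreeOf_C, degreeOf_neg, degreeOf_X, add_zero]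
    simp [eq_comm]

theorem isStronglyRayleigh_of_posSemidef (h : (modDistMatrix G).PosSemidef)
    (hnn : HasNonnegCoeffs (perturbedPoly (modDistMatrix G) 0)) :
    0 < (-1 : ℝ) ^ Fintype.card V * eval (fun _ => (-1 : ℝ)) (blowupPoly G) ∧
      IsStronglyRayleigh (reflectedBlowupPoly G) := by
  have hpos : 0 < (-1 : ℝ) ^ Fintype.card V * eval (fun _ => (-1 : ℝ)) (blowupPoly G) := by
    have h1 := hnn.eval_pos (perturbedPoly_zero_ne_zero _) (x := fun _ => 1) fun _ => one_pos
    rwa [eval_perturbedPoly_none_one G _ rfl] at h1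
  set c := eval (fun _ => (-1 : ℝ)) (blowupPoly G) with hc
  have hc0 : c ≠ 0 := right_ne_zero_of_mul hpos.ne'
  refine ⟨hpos, isMultiAffine_reflectedBlowupPoly G, fun z hz => ?_, ?_, ?_⟩
  · rw [aeval_reflectedBlowupPoly]
    refine mul_ne_zero (by simpa using hc0) fun h0 => ?_
    have h1 := neg_pow_mul_aeval_blowupPoly G z
    rw [h0, mul_zero] at h1
    -- Here z₀ = 1 is real, on the boundary of the half-plane, which is why the pencil lemma allows
    -- Im c = 0.
    exact det_pencil_ne_zero h (c := 2) (by simp) two_ne_zero hz h1.symm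
  -- The reflected polynomial is the homogenization at z₀ = 1 divided by a positive constant, so it
  -- inherits the non-negative coefficients.
  · have h1 : reflectedBlowupPoly G = C ((-1) ^ Fintype.card V * c)⁻¹ *
        aeval (fun i => Option.elim i 1 X) (perturbedPoly (modDistMatrix G) 0) := by
      refine MvPolynomial.funext fun w => ?_
      have h2 : eval w (aeval (fun i => Option.elim i 1 X : Option V → MvPolynomial V ℝ)
          (perturbedPoly (modDistMatrix G) 0)) =
            eval (fun i => Option.elim i 1 w) (perturbedPoly (modDistMatrix G) 0) := by
        rw [aeval_def, algebraMap_eq, eval_eval₂]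
        have h3 : (eval w).comp (C : ℝ →+* MvPolynomial V ℝ) = RingHom.id ℝ := by
          ext x
          simp
        rw [h3]
        refine congrArg (fun g => eval₂ (RingHom.id ℝ) g _) (_root_.funext fun i => ?_)
        cases i <;> simp
      rw [eval_reflectedBlowupPoly, map_mul, eval_C, h2, eval_perturbedPoly_none_one G _ rfl,
        ← hc, mul_inv, ← mul_assoc]
      congr 1
      rw [mul_right_comm, inv_mul_cancel₀ (pow_ne_zero _ (by norm_num)), one_mul]
    rw [h1]
    refine (HasNonnegCoeffs.C (inv_nonneg.2 hpos.le)).mul (hnn.aeval fun i => ?_)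
    cases i with
    | none => rw [Option.elim_none, ← C_1]; exact HasNonnegCoeffs.C zero_le_one
    | some v => exact HasNonnegCoeffs.X v
  · have h1 := eval_reflectedBlowupPoly G fun _ => 1
    rw [← hc, inv_mul_cancel₀ hc0, eval_eq'] at h1
    simpa using h1

theorem posSemidef_of_isStronglyRayleigh
    (hpos : 0 < (-1 : ℝ) ^ Fintype.card V * eval (fun _ => (-1 : ℝ)) (blowupPoly G))
    (h : IsStronglyRayleigh (reflectedBlowupPoly G)) : (modDistMatrix G).PosSemidef := by
  refine posSemidef_of_eval_ne_zero G fun z hz => ?_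
  have hne : reflectedBlowupPoly G ≠ 0 := by
    intro h0
    have h1 := eval_reflectedBlowupPoly G fun _ => 1
    rw [h0, map_zero, inv_mul_cancel₀ (right_ne_zero_of_mul hpos.ne')] at h1
    exact zero_ne_one h1
  have h1 := h.2.2.1.eval_pos hne (x := fun v => z (some v) / z none) fun v =>
    div_pos (hz _) (hz _)
  rw [eval_reflectedBlowupPoly] at h1
  rw [← homBlowupPoly_eq, eval_homBlowupPoly G z (hz none).ne']
  refine mul_ne_zero (pow_ne_zero _ (neg_ne_zero.2 (hz none).ne')) ?_
  simpa only [div_neg] using right_ne_zero_of_mul h1.ne'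

end BlowupPolynomials

end Blowup

/-! ### The equivalences -/

theorem mainTheorem9 {V : Type*} [Fintype V] [DecidableEq V] (G : SimpleGraph V)
    (hG : G.Connected) :
    List.TFAE [
      Blowup.IsRealStable (Blowup.homBlowupPoly G),
      Blowup.HasNonnegCoeffs (Blowup.homBlowupPoly G),
      0 < (-1 : ℝ) ^ Fintype.card V * MvPolynomial.eval (fun _ => (-1 : ℝ)) (Blowup.blowupPoly G) ∧
        Blowup.IsStronglyRayleigh (Blowup.reflectedBlowupPoly G),
      (Blowup.modDistMatrix G).PosSemidef,
      G.IsCompleteMultipartite,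
      Blowup.IsLorentzian (Blowup.homBlowupPoly G),
      Blowup.IsStronglyLogConcave (Blowup.homBlowupPoly G),
      Blowup.IsCompletelyLogConcave (Blowup.homBlowupPoly G)] := by
  rw [Blowup.homBlowupPoly_eq]
  have hoff : ∀ v u, u ≠ v → Blowup.modDistMatrix G v u ≠ 0 := fun v u h =>
    Blowup.modDistMatrix_ne_zero hG h
  tfae_have 4 → 1 := Blowup.isRealStable_perturbedPoly_zero
  tfae_have 1 → 4 := fun h => Blowup.posSemidef_of_eval_ne_zero G fun z hz =>
    Blowup.eval_ne_zero_of_aeval_ne_zero (Blowup.isHomogeneous_perturbedPoly _ _)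
      (h _ fun i => by simpa using hz i)
  tfae_have 2 → 4 := fun h => Blowup.posSemidef_of_eval_ne_zero G fun z hz =>
    (h.eval_pos (Blowup.perturbedPoly_zero_ne_zero _) hz).ne'
  tfae_have 3 → 4 := fun h => Blowup.posSemidef_of_isStronglyRayleigh G h.1 h.2
  tfae_have 4 → 6 := fun h => Blowup.isLorentzian_perturbedPoly_zero h hoff
  tfae_have 6 → 2 := Blowup.hasNonnegCoeffs_of_isLorentzian
  -- The non-negative coefficients needed here come from the Lorentzian property.
  tfae_have 4 → 3 := fun h => Blowup.isStronglyRayleigh_of_posSemidef G h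
    (tfae_6_to_2 (tfae_4_to_6 h))
  tfae_have 4 → 5 := Blowup.isCompleteMultipartite_of_posSemidef hG
  tfae_have 5 → 4 := Blowup.posSemidef_of_isCompleteMultipartite hG
  tfae_have 4 → 8 := fun h => Blowup.isCompletelyLogConcave_perturbedPoly_zero h
    (tfae_6_to_2 (tfae_4_to_6 h))
  tfae_have 8 → 7 := Blowup.isStronglyLogConcave_of_isCompletelyLogConcave
  tfae_have 7 → 2 := fun h => h.1
  tfae_finish
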